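/- Let $G$ be a probability measure on a measurable space $\Psi$. For a $\sigma$-finite measure $\nu$ on $(0,\infty)$, a random measure on $\Psi$ is said to be $\mathrm{CRM}(\nu)$ if it has the law of $\sum_k\theta_k\delta_{\psi_k}$, where the $(\theta_k,\psi_k)$ are the points of a Poisson process with rate measure $\nu\otimes G$. For $\gamma>0$, $\alpha>0$, the beta process $\mathrm{BP}(\gamma,\alpha,0)$ is $\mathrm{CRM}(\nu_{\gamma,\alpha})$ with $\nu_{\gamma,\alpha}(d\theta)=\gamma\alpha\,\mathbf 1[0<\theta\le 1]\,\theta^{-1}(1-\theta)^{\alpha-1}\,d\theta$. For $c>0$ and a probability measure $g$ on $[0,\infty)$, write $\Theta\leftarrow \mathrm{BDrep}(c,g)$ if $\Theta=\sum_{k\ge1}\theta_k\delta_{\psi_k}$ with $\theta_k=V_ke^{-\Gamma_k/c}$, $\Gamma_k=\sum_{i\le k}E_i$, where $E_i\sim\mathrm{Exp}(1)$, $V_k\sim g$, $\psi_k\sim G$ are all mutually independent. Let $\mathrm{Beta}(1,0)$ denote $\delta_1$. (1) If $\alpha\ge1$ and $\Theta\leftarrow\mathrm{BDrep}(\gamma\alpha,\mathrm{Beta}(1,\alpha-1))$,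 then $\Theta\sim\mathrm{BP}(\gamma,\alpha,0)$. (2) Let $\alpha\ge1$, $N,K\in\{0,1,2,\dots\}$, let $\Theta=\sum_k\theta_k\delta_{\psi_k}$ be as in (1) and $\Theta_K=\sum_{k\le K}\theta_k\delta_{\psi_k}$. Let $X_n=\sum_k x_{nk}\delta_{\psi_k}$ for $n\le N$, where, conditionally on $(\theta_k,\psi_k)_k$, the $x_{nk}$ are independent with the Bernoulli likelihood $h(x\mid\theta)=\mathbf 1[x\le1]\theta^x(1-\theta)^{1-x}$ at $\theta=\theta_k$; let $Z_n=\sum_{k\le K}z_{nk}\delta_{\psi_k}$ be built in the same way from $\Theta_K$. Let $f$ be any Markov kernel from measures on $\Psi$ to a measurable space, and let $p_{N,\infty}$ and $p_{N,K}$ be densities, with respect to any common measure, of the marginal laws of $N$ observations that are conditionally independent with laws $f(\cdot\mid X_n)$, respectively $f(\cdot\mid Z_n)$. Put $\pi(\theta)=h(0\mid\theta)=1-\theta$, $G_0=0$, $G_K\sim\mathrm{Gamma}(K,1)$ for $K\ge 1$, and $$B_{N,K}=1-\exp\Big\{-\int\big(1-\mathbb E\big[\pi(ve^{-G_K/(\gamma\alpha)})^N\big]\big)\,\nu_{\gamma,\alpha}(dv)\Big\}.$$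 Then $$\tfrac12\|p_{N,\infty}-p_{N,K}\|_1\;\le\;\mathbb P\big(x_{nk}\ne0\text{ for some }n\le N,\ k>K\big)\;\le\; B_{N,K}\;\le\; N\gamma\Big(\frac{\gamma\alpha}{1+\gamma\alpha}\Big)^K .$$ (3) Let $\alpha>0$ (in particular $\alpha<1$ is allowed). Let $\Theta\sim\mathrm{BP}(\gamma\alpha/(\alpha+1),\alpha+1,0)$ and $\Theta'=\sum_{k=1}^{C}\theta'_k\delta_{\psi'_k}$ with $C\sim\mathrm{Poisson}(\gamma)$, $\theta'_k\sim\mathrm{Beta}(1,\alpha)$, $\psi'_k\sim G$, where $\Theta$, $C$ and all $\theta'_k,\psi'_k$ are mutually independent. Then $\Theta+\Theta'\sim\mathrm{BP}(\gamma,\alpha,0)$. -/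

import Mathlib

open MeasureTheory ProbabilityTheory Set
open scoped ENNReal NNReal

namespace TruncRM

noncomputable section

/-! ### Poisson processes, completely random measures, the beta process -/

/-- `Q` is the law of a Poisson point process on `E` with (σ-finite) rate measure `μ`: the random
measure `M ∼ Q` has Poisson distributed values, independent on disjoint sets.
(For σ-finite `μ` this determines `Q`.) -/
structure IsPoissonProcessLaw {E : Type*} [MeasurableSpace E] (Q : Measure (Measure E))
    (μ : Measure E) : Prop where
  count : ∀ A : Set E, MeasurableSet A → μ A ≠ ∞ →
    Q.map (fun M : Measure E => M A) =
      (poissonMeasure (μ A).toNNReal).map (fun n : ℕ => (n : ℝ≥0∞))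
  indep : ∀ (n : ℕ) (A : Fin n → Set E), (∀ i, MeasurableSet (A i)) →
    Pairwise (fun i j => Disjoint (A i) (A j)) →
    iIndepFun (fun (i : Fin n) (M : Measure E) => M (A i)) Q

/-- The random measure on `Ψ` made of the points of `M`: the measure `∫ θ δ_ψ M(dθ, dψ)`, which is
`∑ θ_k δ_{ψ_k}` when `M = ∑ δ_{(θ_k, ψ_k)}`. -/
def markedSum {Ψ : Type*} [MeasurableSpace Ψ] (M : Measure (ℝ × Ψ)) : Measure Ψ :=
  (M.withDensity (fun z => ENNReal.ofReal z.1)).map Prod.snd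

/-- `Θ ∼ CRM(ν)` with atom locations i.i.d. from `G`: `Θ` has the law of `∑ θ_k δ_{ψ_k}`, where
the `(θ_k, ψ_k)` are the points of a Poisson process with rate measure `ν ⊗ G`. -/
def IsCRM {Ω Ψ : Type*} [MeasurableSpace Ω] [MeasurableSpace Ψ] (P : Measure Ω)
    (G : Measure Ψ) (ν : Measure ℝ) (Θ : Ω → Measure Ψ) : Prop :=
  ∃ Q : Measure (Measure (ℝ × Ψ)), IsPoissonProcessLaw Q (ν.prod G) ∧
    AEMeasurable Θ P ∧ P.map Θ = Q.map markedSum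

/-- The rate measure of the beta process `BP(γ, α, d)`. -/
def betaRate (γ α d : ℝ) : Measure ℝ :=
  (volume.restrict (Ioc 0 1)).withDensity fun θ =>
    ENNReal.ofReal (γ * (Real.Gamma (α + 1) / (Real.Gamma (1 - d) * Real.Gamma (α + d))) *
      θ ^ (-1 - d) * (1 - θ) ^ (α + d - 1))

/-- `Θ ∼ BP(γ, α, d)`. -/
def IsBetaProcess {Ω Ψ : Type*} [MeasurableSpace Ω] [MeasurableSpace Ψ] (P : Measure Ω)
    (G : Measure Ψ) (γ α d : ℝ) (Θ : Ω → Measure Ψ) : Prop :=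
  IsCRM P G (betaRate γ α d) Θ

/-! ### Series -/

/-- The measure `∑_k w_k δ_{ψ_k}`. -/
def atomicMeasure {Ψ : Type*} [MeasurableSpace Ψ] (w : ℕ → ℝ) (ψ : ℕ → Ψ) : Measure Ψ :=
  Measure.sum fun k => ENNReal.ofReal (w k) • Measure.dirac (ψ k)

/-- The measure `∑ w_k δ_{ψ_k}` over the first `K` indices. -/
def atomicMeasureTrunc {Ψ : Type*} [MeasurableSpace Ψ] (K : ℕ) (w : ℕ → ℝ) (ψ : ℕ → Ψ) :
    Measure Ψ :=
  ∑ k ∈ Finset.range K, ENNReal.ofReal (w k) • Measure.dirac (ψ k)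

/-- The ingredients of the Bondesson representation: `E_k ∼ Exp(1)`, `V_k ∼ g`, `ψ_k ∼ G`, all
mutually independent. Indices start at `0`. -/
structure IsBondessonInput {Ω Ψ : Type*} [MeasurableSpace Ω] [MeasurableSpace Ψ] (P : Measure Ω)
    (G : Measure Ψ) (g : Measure ℝ) (E V : ℕ → Ω → ℝ) (ψ : ℕ → Ω → Ψ) : Prop where
  measurable_E : ∀ k, Measurable (E k)
  measurable_V : ∀ k, Measurable (V k)
  measurable_ψ : ∀ k, Measurable (ψ k)
  indep : iIndepFun (fun (k : ℕ) (ω : Ω) => (E k ω, V k ω, ψ k ω)) P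
  law : ∀ k, P.map (fun ω => (E k ω, V k ω, ψ k ω)) = (expMeasure 1).prod (g.prod G)

/-- The `k`-th rate `V_k exp(-Γ_k / c)` of the Bondesson representation, where
`Γ_k = E_0 + ⋯ + E_k`. -/
def bondessonWeight {Ω : Type*} (c : ℝ) (E V : ℕ → Ω → ℝ) (k : ℕ) (ω : Ω) : ℝ :=
  V k ω * Real.exp (-(∑ i ∈ Finset.range (k + 1), E i ω) / c)

/-- `Θ ← B-Rep(c, g)`. -/
def IsBondessonRep {Ω Ψ : Type*} [MeasurableSpace Ω] [MeasurableSpace Ψ] (P : Measure Ω)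
    (G : Measure Ψ) (c : ℝ) (g : Measure ℝ) (Θ : Ω → Measure Ψ) : Prop :=
  ∃ (E V : ℕ → Ω → ℝ) (ψ : ℕ → Ω → Ψ), IsBondessonInput P G g E V ψ ∧
    Θ = fun ω => atomicMeasure (fun k => bondessonWeight c E V k ω) (fun k => ψ k ω)

/-- `Beta(1, b)` for `b ≥ 0`, where `Beta(1, 0)` is the point mass at `1`. -/
def betaOne (b : ℝ) : Measure ℝ :=
  if b = 0 then Measure.dirac 1 else betaMeasure 1 b

/-- `Θ' = ∑_{k < C} θ_k δ_{ψ_k}` with `C ∼ Poisson(γ)`, `θ_k ∼ g` and `ψ_k ∼ G`,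
all mutually independent. -/
structure IsCompoundInput {Ω Ψ : Type*} [MeasurableSpace Ω] [MeasurableSpace Ψ] (P : Measure Ω)
    (G : Measure Ψ) (γ : ℝ) (g : Measure ℝ) (C : Ω → ℕ) (θ : ℕ → Ω → ℝ) (ψ : ℕ → Ω → Ψ) :
    Prop where
  measurable_C : Measurable C
  measurable_θ : ∀ k, Measurable (θ k)
  measurable_ψ : ∀ k, Measurable (ψ k)
  law_C : P.map C = poissonMeasure γ.toNNReal
  law : ∀ k, P.map (fun ω => (θ k ω, ψ k ω)) = g.prod G
  indep : iIndepFun (fun (k : ℕ) (ω : Ω) => (θ k ω, ψ k ω)) P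
  indep_C : IndepFun C (fun ω (k : ℕ) => (θ k ω, ψ k ω)) P

/-! ### Likelihood processes and truncation error -/

/-- The Bernoulli likelihood `h(x | θ) = 1[x ≤ 1] θ^x (1 - θ)^{1 - x}`. -/
def bernoulliLikelihood (θ : ℝ) (x : ℕ) : ℝ :=
  if x ≤ 1 then θ ^ x * (1 - θ) ^ (1 - x) else 0

/-- Conditionally on the rates and locations `(θ_k, ψ_k)_k`, the counts `x n k` are independent
with `x n k ∼ h(· | θ_k)`. -/
structure IsLikelihoodArray {Ω Ψ : Type*} [MeasurableSpace Ω] [MeasurableSpace Ψ]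
    (P : Measure Ω) (h : ℝ → ℕ → ℝ) (θ : ℕ → Ω → ℝ) (ψ : ℕ → Ω → Ψ) {N : ℕ}
    (x : Fin N → ℕ → Ω → ℕ) : Prop where
  measurable : ∀ n k, Measurable (x n k)
  cond_law : ∀ (A : Set (ℕ → ℝ × Ψ)), MeasurableSet A →
    ∀ (S : Finset (Fin N × ℕ)) (a : Fin N × ℕ → ℕ),
    P {ω | (fun k => (θ k ω, ψ k ω)) ∈ A ∧ ∀ s ∈ S, x s.1 s.2 ω = a s} =
      ∫⁻ ω in {ω | (fun k => (θ k ω, ψ k ω)) ∈ A},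
        ∏ s ∈ S, ENNReal.ofReal (h (θ s.2 ω) (a s)) ∂P

/-- `p` is the density with respect to `m` of the marginal law of the observations `Y_1, …, Y_N`,
where conditionally on `X_1, …, X_N` the `Y_n` are independent with `Y_n ∼ f(· | X_n)`. -/
def IsMarginalDensity {Ω Ψ 𝒴 : Type*} [MeasurableSpace Ω] [MeasurableSpace Ψ]
    [MeasurableSpace 𝒴] (P : Measure Ω) (f : Kernel (Measure Ψ) 𝒴) {N : ℕ}
    (X : Fin N → Ω → Measure Ψ) (m : Measure (Fin N → 𝒴)) (p : (Fin N → 𝒴) → ℝ) : Prop :=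
  Measurable p ∧ (∀ y, 0 ≤ p y) ∧
    ∀ A : Fin N → Set 𝒴, (∀ n, MeasurableSet (A n)) →
      ∫⁻ y in Set.pi univ A, ENNReal.ofReal (p y) ∂m = ∫⁻ ω, ∏ n, f (X n ω) (A n) ∂P

/-- The law `Gam(K, 1)` of `G_K`, with `G_0 = 0`. -/
def gammaLaw (K : ℕ) : Measure ℝ :=
  if K = 0 then Measure.dirac 0 else gammaMeasure K 1

/-- The truncation error bound of the Bondesson representation with scale `c` of `CRM(ν)`,
`B_{N,K} = 1 - exp(-∫ (1 - 𝔼[π(v e^{-G_K/c})^N]) ν(dv))`, where `π(θ) = h(0 | θ)`. -/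
def bondessonTruncBound (h : ℝ → ℕ → ℝ) (ν : Measure ℝ) (c : ℝ) (N K : ℕ) : ℝ :=
  1 - Real.exp (-∫ v, (1 - ∫ t, (h (v * Real.exp (-t / c)) 0) ^ N ∂(gammaLaw K)) ∂ν)

end

end TruncRM

namespace TruncRM

open Filter Topology

/-! ### The exponential renewal identity -/

-- All three statements rest on the exponential formula for marked Poisson arrivals, proved from
-- arrival `K` onwards instead of only from time zero. For a test function `Φ(t, w)` with `‖Φ‖ ≤ 1`,
-- put `g(t) = ∫ (1 - Φ(t, w)) H(dw)` and `v(s) = exp(-∫_s^∞ g)`. Waiting one `Exp(1)` time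
-- reproduces `v`: `𝔼[(1 - g(s + T)) v(s + T)] = v(s)` (`integral_exp_renewal`). Hence `∏_{K ≤ k <
-- K+n} Φ(Γ_{k+1}, W_k) · v(Γ_{K+n})` has expectation `𝔼 v(Γ_K)` for every `n`, and since `Γ_n → ∞`
-- almost surely and `v → 1` at infinity, the factor `v` disappears in the limit
-- (`IsMarkedArrivals.tendsto_integral_prod`).
--
-- Part (1) is the case `K = 0`. The map `(t, v, ψ) ↦ (v e^{-t/c}, ψ)` carries Lebesgue ⊗ `Beta(1,
-- α-1)` ⊗ `G` to the beta rate times `G`, because for fixed `v` the image of `dt` is `(c/θ) dθ` on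
-- `(0, v)` and the beta tail is `(1-θ)^{α-1}` (`map_bondesson_rate`). The exponential formula then
-- yields the joint characteristic functions of counts on disjoint sets, and these identify a
-- Poisson process (`HasPoissonCharFun.isPoissonProcessLaw`).
--
-- For part (2), total variation is at most the probability that the two underlying models differ
-- under a coupling. The event that no count from `K` on is nonzero has probability `𝔼 ∏_{k ≥ K} (1
-- - θ_k)^N`. The exponential formula turns this into `𝔼 exp(-J(Γ_K))`, with `Γ_K ∼ Gamma(K, 1)`,
-- and Jensen's inequality bounds it below by `exp(-𝔼 J(Γ_K)) = 1 - B_{N,K}`. The explicit bound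
-- uses `1 - e^{-I} ≤ I`, Bernoulli's inequality, the first moment `γ` of the rate, and `𝔼
-- e^{-Γ_K/c} = (c/(1+c))^K`.
--
-- Part (3) is superposition: independent Poisson processes add, a Poisson number of i.i.d. points
-- is a Poisson process (`hasPoissonCharFun_compound`), and the two rates sum to the required one
-- because `(1 - θ) + θ = 1` (`betaRate_add`).

theorem integral_expMeasure_one (f : ℝ → ℂ) :
    ∫ t, f t ∂(expMeasure 1) = ∫ t in Ioi (0 : ℝ), Real.exp (-t) • f t := by
  rw [expMeasure, gammaMeasure, integral_withDensity_eq_integral_toReal_smul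
    (by unfold gammaPDF; fun_prop) (ae_of_all _ fun x => by simp [gammaPDF])]
  rw [← integral_Ici_eq_integral_Ioi, ← integral_indicator measurableSet_Ici]
  refine integral_congr_ae (ae_of_all _ fun x => ?_)
  by_cases hx : 0 ≤ x
  · simp [gammaPDF, gammaPDFReal, hx, (Real.exp_pos _).le]
  · simp [gammaPDF, gammaPDFReal, hx]

/-- The integrand is minus the derivative of `exp(-∫_0^t p)`. As `p` is only measurable, this holds
almost everywhere, so the ordinary fundamental theorem is replaced by the constancy of an absolutely
continuous function whose derivative vanishes almost everywhere. Boundedness of `p` supplies the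
Lipschitz estimates. -/
theorem intervalIntegral_mul_exp_neg_primitive {p : ℝ → ℂ} (hp : Measurable p)
    (hp1 : ∀ t, ‖p t‖ ≤ 1) {T : ℝ} (hT : 0 ≤ T) :
    ∫ t in (0 : ℝ)..T, p t * Complex.exp (-∫ r in (0 : ℝ)..t, p r) =
      1 - Complex.exp (-∫ r in (0 : ℝ)..T, p r) := by
  have lip : ∀ {q : ℝ → ℂ} {C : ℝ}, Measurable q → 0 ≤ C → (∀ t ∈ Icc 0 T, ‖q t‖ ≤ C) →
      LipschitzOnWith C.toNNReal (fun t => ∫ r in (0 : ℝ)..t, q r) (Icc 0 T) := by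
    intro q C hq hC hqC
    have hint : ∀ a ∈ Icc 0 T, IntervalIntegrable q volume 0 a := by
      intro a ha
      rw [intervalIntegrable_iff_integrableOn_Ioc_of_le ha.1]
      refine Measure.integrableOn_of_bounded (M := C) (by simp) hq.aestronglyMeasurable ?_
      filter_upwards [ae_restrict_mem measurableSet_Ioc] with x hx
      exact hqC x ⟨hx.1.le, hx.2.trans ha.2⟩
    refine LipschitzOnWith.of_dist_le_mul fun a ha b hb => ?_
    rw [dist_eq_norm, intervalIntegral.integral_interval_sub_left (hint a ha) (hint b hb),
      Real.coe_toNNReal _ hC, Real.dist_eq]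
    refine intervalIntegral.norm_integral_le_of_norm_le_const fun x hx => hqC x ?_
    rw [uIoc_eq_union] at hx
    rcases hx with hx | hx
    · exact ⟨hb.1.trans hx.1.le, hx.2.trans ha.2⟩
    · exact ⟨ha.1.trans hx.1.le, hx.2.trans hb.2⟩
  set R : ℝ → ℂ := fun t => ∫ r in (0 : ℝ)..t, p r with hR
  have hloc : LocallyIntegrable p volume := by
    refine (locallyIntegrable_const (1 : ℝ)).mono hp.aestronglyMeasurable
      (ae_of_all _ fun x => by simpa using hp1 x)
  have hRc : Continuous R := intervalIntegral.continuous_primitive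
    (fun a b => (intervalIntegrable_iff.mpr <|
      (hloc.integrableOn_isCompact isCompact_uIcc).mono_set uIoc_subset_uIcc)) 0
  set q : ℝ → ℂ := fun t => p t * Complex.exp (-R t) with hq
  have hqm : Measurable q := hp.mul (Complex.measurable_exp.comp hRc.measurable.neg)
  have hRb : ∀ t ∈ Icc 0 T, ‖R t‖ ≤ T := by
    intro t ht
    have := intervalIntegral.norm_integral_le_of_norm_le_const (a := 0) (b := t) (f := p) (C := 1)
      fun x _ => hp1 x
    rw [sub_zero, one_mul, abs_of_nonneg ht.1] at this
    exact this.trans ht.2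
  have hqb : ∀ t ∈ Icc 0 T, ‖q t‖ ≤ Real.exp T := by
    intro t ht
    rw [hq, norm_mul, Complex.norm_exp]
    refine (mul_le_of_le_one_left (Real.exp_pos _).le (hp1 t)).trans (Real.exp_le_exp.2 ?_)
    rw [Complex.neg_re]
    exact (neg_le_abs _).trans ((Complex.abs_re_le_norm _).trans (hRb t ht))
  have hlocq : LocallyIntegrable q volume := by
    have hc : Continuous fun t => Real.exp ‖R t‖ := Real.continuous_exp.comp hRc.norm
    refine hc.locallyIntegrable.mono hqm.aestronglyMeasurable (ae_of_all _ fun x => ?_)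
    rw [hq, norm_mul, Complex.norm_exp, Real.norm_of_nonneg (Real.exp_pos _).le]
    refine (mul_le_of_le_one_left (Real.exp_pos _).le (hp1 x)).trans (Real.exp_le_exp.2 ?_)
    rw [Complex.neg_re]
    exact (neg_le_abs _).trans (Complex.abs_re_le_norm _)
  have hexp : AbsolutelyContinuousOnInterval (fun t => Complex.exp (-R t)) 0 T := by
    have h1 : LipschitzOnWith (Real.exp T).toNNReal (fun z : ℂ => Complex.exp (-z))
        (Metric.closedBall 0 T) := by
      refine (convex_closedBall (0 : ℂ) T).lipschitzOnWith_of_nnnorm_deriv_le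
        (fun x _ => by fun_prop) fun x hx => ?_
      have hd : deriv (fun z : ℂ => Complex.exp (-z)) x = -Complex.exp (-x) := by
        simpa using ((hasDerivAt_neg x).cexp).deriv
      rw [hd, ← NNReal.coe_le_coe, Real.coe_toNNReal _ (Real.exp_pos _).le, coe_nnnorm, norm_neg,
        Complex.norm_exp, Real.exp_le_exp, Complex.neg_re]
      exact (neg_le_abs _).trans ((Complex.abs_re_le_norm _).trans (by simpa using hx))
    have h2 := h1.comp (lip hp zero_le_one fun t _ => hp1 t) (fun t ht => by
      simpa using hRb t ht)
    rw [← uIcc_of_le hT] at h2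
    exact h2.absolutelyContinuousOnInterval
  have hprim : AbsolutelyContinuousOnInterval (fun t => ∫ r in (0 : ℝ)..t, q r) 0 T := by
    have h2 := lip hqm (Real.exp_pos T).le hqb
    rw [← uIcc_of_le hT] at h2
    exact h2.absolutelyContinuousOnInterval
  -- The function shown to be constant is `exp(-R(t)) + ∫_0^t q`; comparing its values at `0` and
  -- `T` gives the identity.
  obtain ⟨c, hc⟩ := (hexp.add hprim).const_of_ae_hasDerivAt_zero (by
    filter_upwards [_root_.LocallyIntegrable.ae_hasDerivAt_integral hloc,
      _root_.LocallyIntegrable.ae_hasDerivAt_integral hlocq] with x h1 h2 _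
    have := ((h1 0).neg.cexp).add (h2 0)
    have hz : Complex.exp ((-fun x => ∫ t in (0 : ℝ)..x, p t) x) * -p x + q x = 0 := by
      simp only [hq, hR, Pi.neg_apply]
      ring
    rw [hz] at this
    exact this)
  have h0 := hc 0 (by simp)
  have hTc := hc T (by simp)
  simp only [Pi.add_apply, intervalIntegral.integral_same, hR, neg_zero, Complex.exp_zero,
    add_zero] at h0 hTc
  rw [← h0] at hTc
  rw [← hTc]
  simp [hq, hR]

/-- With `p(t) = 1 - g(s + t)`, the exponential density combines with the tail integral: `e^{-t}
exp(-∫_{s+t}^∞ g) = exp(-∫_s^∞ g) · exp(-∫_0^t p)`. The integrand becomes an exact derivative up to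
a constant factor. Its boundary term at infinity vanishes because `∫_0^t p` differs from `t` by a
bounded amount. -/
theorem integral_exp_renewal {g : ℝ → ℂ} (hg : Measurable g) (hg1 : ∀ t, ‖1 - g t‖ ≤ 1)
    (hgi : IntegrableOn g (Ioi 0)) {s : ℝ} (hs : 0 ≤ s) :
    ∫ t, (1 - g (s + t)) * Complex.exp (-∫ r in Ioi (s + t), g r) ∂(expMeasure 1) =
      Complex.exp (-∫ r in Ioi s, g r) := by
  set p : ℝ → ℂ := fun t => 1 - g (s + t) with hp
  have hpm : Measurable p := by fun_prop
  have hp1 : ∀ t, ‖p t‖ ≤ 1 := fun t => hg1 _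
  have hgs : IntegrableOn g (Ioi s) := hgi.mono_set (Ioi_subset_Ioi hs)
  have hii : ∀ t, 0 ≤ t → IntervalIntegrable g volume s (s + t) := fun t ht =>
    (intervalIntegrable_iff_integrableOn_Ioc_of_le (by linarith)).2
      (hgs.mono_set Ioc_subset_Ioi_self)
  have hprim : ∀ t, 0 ≤ t → ∫ r in (0 : ℝ)..t, p r = t - ∫ r in s..(s + t), g r := by
    intro t ht
    have h2 : IntervalIntegrable (fun r => g (s + r)) volume 0 t := by
      have := (hii t ht).comp_add_left s
      simpa using this
    rw [hp, intervalIntegral.integral_sub (by simp) h2,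
      intervalIntegral.integral_comp_add_left (fun r => g r) s]
    simp
  have htail : ∀ t, 0 ≤ t →
      (∫ r in Ioi (s + t), g r) = (∫ r in Ioi s, g r) - ∫ r in s..(s + t), g r := by
    intro t ht
    rw [eq_sub_iff_add_eq', intervalIntegral.integral_interval_add_Ioi hgs
      (hgs.mono_set (Ioi_subset_Ioi (by linarith)))]
  rw [integral_expMeasure_one]
  have hcong : ∀ t ∈ Ioi (0 : ℝ), Real.exp (-t) • ((1 - g (s + t)) *
      Complex.exp (-∫ r in Ioi (s + t), g r)) = Complex.exp (-∫ r in Ioi s, g r) *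
        (p t * Complex.exp (-∫ r in (0 : ℝ)..t, p r)) := by
    intro t ht
    have ht' : (0 : ℝ) ≤ t := le_of_lt ht
    rw [htail t ht', hprim t ht', Complex.real_smul, Complex.ofReal_exp, hp]
    rw [mul_left_comm, ← Complex.exp_add, mul_left_comm, ← Complex.exp_add]
    congr 2
    push_cast
    ring
  rw [setIntegral_congr_fun measurableSet_Ioi hcong, integral_const_mul]
  set B : ℝ := ∫ r in Ioi s, ‖g r‖ with hB
  have hbound : ∀ t, 0 ≤ t → ‖Complex.exp (-∫ r in (0 : ℝ)..t, p r)‖ ≤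
      Real.exp B * Real.exp (-t) := by
    intro t ht
    rw [hprim t ht, Complex.norm_exp, ← Real.exp_add, Real.exp_le_exp]
    have h1 : ‖∫ r in s..(s + t), g r‖ ≤ B := by
      rw [intervalIntegral.integral_of_le (by linarith)]
      refine (norm_integral_le_integral_norm _).trans ?_
      exact setIntegral_mono_set hgs.norm (ae_of_all _ fun _ => norm_nonneg _)
        Ioc_subset_Ioi_self.eventuallyLE
    have h2 := (Complex.re_le_norm _).trans h1
    simp only [Complex.neg_re, Complex.sub_re, Complex.ofReal_re]
    linarith
  have hexpi : IntegrableOn (fun t : ℝ => Real.exp B * Real.exp (-t)) (Ioi 0) :=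
    (integrableOn_exp_neg_Ioi 0).const_mul _
  have hcont : AEStronglyMeasurable (fun t => p t * Complex.exp (-∫ r in (0 : ℝ)..t, p r))
      (volume.restrict (Ioi 0)) := by
    have hloc : LocallyIntegrable p volume :=
      (locallyIntegrable_const (1 : ℝ)).mono hpm.aestronglyMeasurable
        (ae_of_all _ fun x => by simpa using hp1 x)
    have hRc : Continuous (fun t => ∫ r in (0 : ℝ)..t, p r) := intervalIntegral.continuous_primitive
      (fun a b => (intervalIntegrable_iff.mpr <|
        (hloc.integrableOn_isCompact isCompact_uIcc).mono_set uIoc_subset_uIcc)) 0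
    exact (hpm.mul (Complex.measurable_exp.comp hRc.measurable.neg)).aestronglyMeasurable
  have hint : IntegrableOn (fun t => p t * Complex.exp (-∫ r in (0 : ℝ)..t, p r)) (Ioi 0) := by
    refine hexpi.mono' hcont ?_
    filter_upwards [ae_restrict_mem measurableSet_Ioi] with t ht
    rw [norm_mul]
    exact (mul_le_of_le_one_left (norm_nonneg _) (hp1 t)).trans (hbound t (le_of_lt ht))
  have hlim1 := intervalIntegral_tendsto_integral_Ioi 0 hint tendsto_id
  have hlim2 : Tendsto (fun T : ℝ => ∫ t in (0 : ℝ)..T,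
      p t * Complex.exp (-∫ r in (0 : ℝ)..t, p r)) atTop (𝓝 (1 - 0)) := by
    have hz : Tendsto (fun T : ℝ => Complex.exp (-∫ r in (0 : ℝ)..T, p r)) atTop (𝓝 0) := by
      refine squeeze_zero_norm' ((eventually_ge_atTop 0).mono fun t ht => hbound t ht) ?_
      simpa using (Real.tendsto_exp_neg_atTop_nhds_zero).const_mul (Real.exp B)
    refine (tendsto_const_nhds.sub hz).congr' ?_
    filter_upwards [eventually_ge_atTop 0] with T hT
    exact (intervalIntegral_mul_exp_neg_primitive hpm hp1 hT).symm
  rw [tendsto_nhds_unique hlim1 hlim2]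
  simp

end TruncRM
namespace TruncRM
open Filter Topology

/-! ### Independence of the past and the next variable -/

theorem indepFun_prefix {Ω β δ : Type*} [MeasurableSpace Ω] [MeasurableSpace β]
    [MeasurableSpace δ] {P : Measure Ω} {Y : ℕ → Ω → β} (hY : ∀ k, Measurable (Y k))
    (hind : iIndepFun Y P) (n : ℕ) {F : (ℕ → β) → δ} (hF : Measurable F)
    (hdep : ∀ y y' : ℕ → β, (∀ i < n, y i = y' i) → F y = F y') :
    IndepFun (fun ω => F fun i => Y i ω) (Y n) P := by
  rcases isEmpty_or_nonempty β with hβ | ⟨⟨b⟩⟩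
  · have : IsEmpty Ω := ⟨fun ω => hβ.elim (Y 0 ω)⟩
    rw [show P = 0 from Measure.eq_zero_of_isEmpty P]
    simp [IndepFun_iff]
  have h := hind.indepFun_finset (Finset.range n) {n} (by simp) hY
  -- Pads a prefix of length `n` to a full sequence with the arbitrary value `b`; `hdep` makes the
  -- padding invisible to `F`.
  let ext : (Finset.range n → β) → ℕ → β := fun x i =>
    if h : i ∈ Finset.range n then x ⟨i, h⟩ else b
  have hext : Measurable ext := by
    refine measurable_pi_lambda _ fun i => ?_
    by_cases hi : i ∈ Finset.range n
    · simp only [ext, hi, dif_pos]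
      exact measurable_pi_apply _
    · simp only [ext, hi, dif_neg, not_false_iff]
      exact measurable_const
  have h2 := h.comp (hF.comp hext)
    (measurable_pi_apply (⟨n, Finset.mem_singleton_self n⟩ : ({n} : Finset ℕ)))
  refine h2.congr (ae_of_all _ fun ω => hdep _ _ fun i hi => ?_) (ae_of_all _ fun ω => rfl)
  simp [ext, hi]

theorem IndepFun.integral_comp_eq {Ω β δ : Type*} [MeasurableSpace Ω] [MeasurableSpace β]
    [MeasurableSpace δ] {P : Measure Ω} [IsProbabilityMeasure P] {X : Ω → β} {Y : Ω → δ}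
    (hX : Measurable X) (hY : Measurable Y) (h : IndepFun X Y P) {k : β × δ → ℂ}
    (hk : Measurable k) {C : ℝ} (hC : ∀ z, ‖k z‖ ≤ C) :
    ∫ ω, k (X ω, Y ω) ∂P = ∫ ω, ∫ y, k (X ω, y) ∂(P.map Y) ∂P := by
  have := Measure.isProbabilityMeasure_map (μ := P) hX.aemeasurable
  have := Measure.isProbabilityMeasure_map (μ := P) hY.aemeasurable
  rw [← integral_map (hX.prodMk hY).aemeasurable hk.aestronglyMeasurable,
    (indepFun_iff_map_prod_eq_prod_map_map hX.aemeasurable hY.aemeasurable).1 h,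
    integral_prod _ ((integrable_const C).mono' hk.aestronglyMeasurable (ae_of_all _ hC)),
    integral_map hX.aemeasurable]
  exact hk.stronglyMeasurable.integral_prod_right'.aestronglyMeasurable

/-! ### Marked Poisson arrivals -/

/-- The `n`-th partial sum of the interarrival times. -/
def arrival {Ω : Type*} (E : ℕ → Ω → ℝ) (n : ℕ) (ω : Ω) : ℝ := ∑ i ∈ Finset.range n, E i ω

theorem expMeasure_Iic_zero : expMeasure 1 (Iic 0) = 0 := by
  rw [expMeasure, gammaMeasure, withDensity_apply _ measurableSet_Iic,
    ← setLIntegral_congr Iio_ae_eq_Iic]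
  exact lintegral_gammaPDF_of_nonpos le_rfl

/-- `E_k ∼ Exp(1)` and marks `W_k ∼ H`, all independent. -/
structure IsMarkedArrivals {Ω 𝒲 : Type*} [MeasurableSpace Ω] [MeasurableSpace 𝒲] (P : Measure Ω)
    (H : Measure 𝒲) (E : ℕ → Ω → ℝ) (W : ℕ → Ω → 𝒲) : Prop where
  measurable_E : ∀ k, Measurable (E k)
  measurable_W : ∀ k, Measurable (W k)
  indep : iIndepFun (fun (k : ℕ) (ω : Ω) => (E k ω, W k ω)) P
  law : ∀ k, P.map (fun ω => (E k ω, W k ω)) = (expMeasure 1).prod H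

section Arrivals

variable {Ω 𝒲 : Type*} [MeasurableSpace Ω] [MeasurableSpace 𝒲] {P : Measure Ω}
  {H : Measure 𝒲} {E : ℕ → Ω → ℝ} {W : ℕ → Ω → 𝒲}

instance isProbabilityMeasure_expMeasure_one : IsProbabilityMeasure (expMeasure 1) :=
  isProbabilityMeasure_expMeasure one_pos

theorem IsMarkedArrivals.map_E [IsProbabilityMeasure H]
    (h : IsMarkedArrivals P H E W) (k : ℕ) :
    P.map (E k) = expMeasure 1 := by
  have h1 := congrArg (Measure.map Prod.fst) (h.law k)
  rw [Measure.map_map measurable_fst ((h.measurable_E k).prodMk (h.measurable_W k))] at h1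
  simpa [Function.comp_def, Measure.map_fst_prod] using h1

theorem IsMarkedArrivals.measurable_arrival (h : IsMarkedArrivals P H E W) (n : ℕ) :
    Measurable (arrival E n) :=
  Finset.measurable_sum _ fun i _ => h.measurable_E i

theorem IsMarkedArrivals.ae_pos [IsProbabilityMeasure H]
    (h : IsMarkedArrivals P H E W) : ∀ᵐ ω ∂P, ∀ k, 0 < E k ω := by
  rw [ae_all_iff]
  intro k
  have : ∀ᵐ x ∂(P.map (E k)), 0 < x := by
    rw [h.map_E, ae_iff]
    simpa [Iic] using expMeasure_Iic_zero
  exact ae_of_ae_map (h.measurable_E k).aemeasurable this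

theorem IsMarkedArrivals.tendsto_arrival [IsProbabilityMeasure P] [IsProbabilityMeasure H]
    (h : IsMarkedArrivals P H E W) :
    ∀ᵐ ω ∂P, Tendsto (fun n => arrival E n ω) atTop atTop := by
  -- A bounded variable below `E k`, with positive mean: the strong law applies to it without any
  -- moment computation for the exponential law, and its partial sums already diverge.
  set X : ℕ → Ω → ℝ := fun k ω => 1 - Real.exp (-|E k ω|) with hXdef
  have hm : ∀ k, Measurable (X k) := fun k =>
    measurable_const.sub (Real.measurable_exp.comp (h.measurable_E k).abs.neg)
  have hid : ∀ i, IdentDistrib (X i) (X 0) P P := by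
    intro i
    have : IdentDistrib (E i) (E 0) P P :=
      ⟨(h.measurable_E i).aemeasurable, (h.measurable_E 0).aemeasurable, by
        rw [h.map_E, h.map_E]⟩
    exact this.comp (u := fun x : ℝ => 1 - Real.exp (-|x|)) (by fun_prop)
  have hb : ∀ k ω, 0 ≤ X k ω ∧ X k ω ≤ 1 := fun k ω =>
    ⟨sub_nonneg.2 (Real.exp_le_one_iff.2 (neg_nonpos.2 (abs_nonneg _))),
      sub_le_self _ (Real.exp_pos _).le⟩
  have hint : Integrable (X 0) P :=
    (integrable_const (1 : ℝ)).mono' (hm 0).aestronglyMeasurable (ae_of_all _ fun ω => by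
      rw [Real.norm_of_nonneg (hb 0 ω).1]; exact (hb 0 ω).2)
  have hpos : 0 < ∫ ω, X 0 ω ∂P := by
    rw [integral_pos_iff_support_of_nonneg (fun ω => (hb 0 ω).1) hint]
    have : (Function.support (X 0) : Set Ω) =ᵐ[P] univ := by
      refine eventuallyEq_univ.2 ?_
      filter_upwards [h.ae_pos] with ω hω
      have : Real.exp (-|E 0 ω|) < 1 := Real.exp_lt_one_iff.2 (by simpa using (hω 0).ne')
      exact (sub_pos.2 this).ne'
    rw [measure_congr this]
    simp
  have hslln := strong_law_ae_real X hint (fun i j hij => by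
    have := h.indep.indepFun hij
    exact this.comp (φ := fun z : ℝ × 𝒲 => 1 - Real.exp (-|z.1|))
      (ψ := fun z : ℝ × 𝒲 => 1 - Real.exp (-|z.1|)) (by fun_prop) (by fun_prop)) hid
  filter_upwards [hslln, h.ae_pos] with ω h1 h2
  have h3 := h1.pos_mul_atTop hpos tendsto_natCast_atTop_atTop
  refine tendsto_atTop_mono' _ ?_ h3
  filter_upwards [eventually_gt_atTop 0] with n hn
  have hn' : (n : ℝ) ≠ 0 := by positivity
  rw [div_mul_cancel₀ _ hn']
  refine Finset.sum_le_sum fun i _ => ?_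
  have := Real.add_one_le_exp (-E i ω)
  simp only [hXdef, abs_of_pos (h2 i)]
  linarith

/-- The martingale identity behind the exponential formula. -/
theorem IsMarkedArrivals.integral_prod_mul [IsProbabilityMeasure P] [IsProbabilityMeasure H]
    (h : IsMarkedArrivals P H E W)
    {Φ : ℝ × 𝒲 → ℂ} (hΦ : Measurable Φ) (hΦ1 : ∀ z, ‖Φ z‖ ≤ 1) {v : ℝ → ℂ} (hv : Measurable v)
    (hv1 : ∀ s, ‖v s‖ ≤ 1)
    (hfix : ∀ s, 0 ≤ s →
      ∫ z, Φ (s + z.1, z.2) * v (s + z.1) ∂((expMeasure 1).prod H) = v s) (K n : ℕ) :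
    ∫ ω, (∏ k ∈ Finset.Ico K (K + n), Φ (arrival E (k + 1) ω, W k ω)) * v (arrival E (K + n) ω) ∂P
      = ∫ ω, v (arrival E K ω) ∂P := by
  induction n with
  | zero => simp
  | succ n ih =>
    rw [← ih]
    let S : ℕ → (ℕ → ℝ × 𝒲) → ℝ := fun n y => ∑ i ∈ Finset.range n, (y i).1
    -- The whole past enters only through the accumulated product and the current arrival time, and
    -- this pair is independent of the next step.
    let F : (ℕ → ℝ × 𝒲) → ℂ × ℝ := fun y =>
      (∏ k ∈ Finset.Ico K (K + n), Φ (S (k + 1) y, (y k).2), S (K + n) y)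
    have hS : ∀ n, Measurable (S n) := fun n => Finset.measurable_sum _ fun i _ =>
      measurable_fst.comp (measurable_pi_apply i)
    have hF : Measurable F := by
      refine Measurable.prodMk (Finset.measurable_prod _ fun k _ => hΦ.comp ?_) (hS _)
      exact (hS _).prodMk (measurable_snd.comp (measurable_pi_apply k))
    have hSd : ∀ y y' : ℕ → ℝ × 𝒲, (∀ i < K + n, y i = y' i) → ∀ m ≤ K + n, S m y = S m y' := by
      intro y y' hy m hm
      refine Finset.sum_congr rfl fun i hi => ?_
      rw [hy i (by have := Finset.mem_range.1 hi; omega)]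
    have hind := indepFun_prefix (fun k => (h.measurable_E k).prodMk (h.measurable_W k)) h.indep
      (K + n) hF (fun y y' hy => by
        refine Prod.ext ?_ (hSd y y' hy _ le_rfl)
        change ∏ k ∈ Finset.Ico K (K + n), Φ (S (k + 1) y, (y k).2) =
          ∏ k ∈ Finset.Ico K (K + n), Φ (S (k + 1) y', (y' k).2)
        refine Finset.prod_congr rfl fun k hk => ?_
        have hk' := (Finset.mem_Ico.1 hk).2
        rw [hSd y y' hy (k + 1) (by omega), hy k hk'])
    have hm : ∀ k, Measurable fun ω => (E k ω, W k ω) := fun k =>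
      (h.measurable_E k).prodMk (h.measurable_W k)
    -- Cuts off outside the unit disc so that the kernel `k` below is bounded on its whole domain,
    -- as the Fubini step requires; the actual products lie in the disc and are unchanged.
    let bnd : ℂ → ℂ := fun z => if ‖z‖ ≤ 1 then z else 0
    have hbm : Measurable bnd :=
      Measurable.ite (measurableSet_le measurable_norm measurable_const) measurable_id
        measurable_const
    have hbb : ∀ z, ‖bnd z‖ ≤ 1 := fun z => by
      by_cases hz : ‖z‖ ≤ 1 <;> simp [bnd, hz]
    have hR1 : ∀ ω, ‖∏ k ∈ Finset.Ico K (K + n), Φ (arrival E (k + 1) ω, W k ω)‖ ≤ 1 := fun ω => by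
      rw [norm_prod]
      exact Finset.prod_le_one (fun _ _ => norm_nonneg _) fun _ _ => hΦ1 _
    have hbe : ∀ ω, bnd (∏ k ∈ Finset.Ico K (K + n), Φ (arrival E (k + 1) ω, W k ω)) =
        ∏ k ∈ Finset.Ico K (K + n), Φ (arrival E (k + 1) ω, W k ω) := fun ω => if_pos (hR1 ω)
    let k : (ℂ × ℝ) × (ℝ × 𝒲) → ℂ := fun q =>
      bnd q.1.1 * (Φ (q.1.2 + q.2.1, q.2.2) * v (q.1.2 + q.2.1))
    have hk : Measurable k := by
      have : Measurable fun q : (ℂ × ℝ) × (ℝ × 𝒲) => (q.1.2 + q.2.1, q.2.2) := by fun_prop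
      exact (hbm.comp (by fun_prop)).mul ((hΦ.comp this).mul (hv.comp (by fun_prop)))
    have hmain := IndepFun.integral_comp_eq
      (hF.comp (measurable_pi_lambda _ hm)) (hm (K + n)) hind hk (C := 1) (fun q => by
        simp only [k, norm_mul]
        exact mul_le_one₀ (hbb _) (by positivity) (mul_le_one₀ (hΦ1 _) (norm_nonneg _) (hv1 _)))
    refine Eq.trans ?_ (hmain.trans ?_)
    · refine integral_congr_ae (ae_of_all _ fun ω => ?_)
      simp only [k, F, S, Function.comp_apply]
      rw [← arrival, show (∏ k ∈ Finset.Ico K (K + n), Φ (∑ i ∈ Finset.range (k + 1), E i ω, W k ω))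
        = ∏ k ∈ Finset.Ico K (K + n), Φ (arrival E (k + 1) ω, W k ω) from rfl, hbe,
        ← add_assoc, Finset.prod_Ico_succ_top (by omega), mul_assoc]
      simp [arrival, Finset.sum_range_succ]
    · refine integral_congr_ae ?_
      filter_upwards [h.ae_pos] with ω hω
      simp only [k, F, S, Function.comp_apply]
      rw [← arrival, show (∏ k ∈ Finset.Ico K (K + n), Φ (∑ i ∈ Finset.range (k + 1), E i ω, W k ω))
        = ∏ k ∈ Finset.Ico K (K + n), Φ (arrival E (k + 1) ω, W k ω) from rfl, hbe,
        integral_const_mul, h.law,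
        hfix (arrival E (K + n) ω) (Finset.sum_nonneg fun i _ => (hω i).le)]

/-- The exponential formula for the marked arrivals after the `K`-th one. -/
theorem IsMarkedArrivals.tendsto_integral_prod [IsProbabilityMeasure P] [IsProbabilityMeasure H]
    (h : IsMarkedArrivals P H E W)
    {Φ : ℝ × 𝒲 → ℂ} (hΦ : Measurable Φ) (hΦ1 : ∀ z, ‖Φ z‖ ≤ 1)
    (hint : Integrable (fun z => 1 - Φ z) ((volume.restrict (Ioi 0)).prod H)) (K : ℕ) :
    Tendsto (fun n => ∫ ω, ∏ k ∈ Finset.Ico K (K + n), Φ (arrival E (k + 1) ω, W k ω) ∂P) atTop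
      (𝓝 (∫ ω, Complex.exp (-∫ r in Ioi (arrival E K ω), ∫ w, (1 - Φ (r, w)) ∂H) ∂P)) := by
  set g : ℝ → ℂ := fun r => ∫ w, (1 - Φ (r, w)) ∂H with hg
  have hΦi : ∀ r, Integrable (fun w => Φ (r, w)) H := fun r =>
    (integrable_const (1 : ℝ)).mono' (hΦ.comp measurable_prodMk_left).aestronglyMeasurable
      (ae_of_all _ fun w => hΦ1 _)
  have hg1 : ∀ r, 1 - g r = ∫ w, Φ (r, w) ∂H := fun r => by
    rw [hg]
    simp only
    rw [integral_sub (integrable_const _) (hΦi r)]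
    simp
  have hgn : ∀ r, ‖1 - g r‖ ≤ 1 := fun r => by
    rw [hg1]
    refine (norm_integral_le_of_norm_le_const (C := 1) (ae_of_all _ fun w => hΦ1 _)).trans ?_
    simp
  have hgm : Measurable g := by
    have : StronglyMeasurable fun z : ℝ × 𝒲 => 1 - Φ z := (measurable_const.sub hΦ).stronglyMeasurable
    exact this.integral_prod_right'.measurable
  have hgi : IntegrableOn g (Ioi 0) := hint.integral_prod_left
  set v : ℝ → ℂ := fun s => Complex.exp (-∫ r in Ioi s, g r) with hv
  have hvm : Measurable v := by
    have h1 : Measurable fun z : ℝ × ℝ => (Ioi z.1).indicator g z.2 := by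
      have : (fun z : ℝ × ℝ => (Ioi z.1).indicator g z.2) =
          {z : ℝ × ℝ | z.1 < z.2}.indicator fun z => g z.2 := by
        funext z
        simp [indicator]
      rw [this]
      exact (hgm.comp measurable_snd).indicator (measurableSet_lt measurable_fst measurable_snd)
    have h2 := h1.stronglyMeasurable.integral_prod_right' (ν := volume)
    have h3 : Measurable fun s => ∫ r in Ioi s, g r := by
      have := h2.measurable
      simpa [integral_indicator measurableSet_Ioi] using this
    exact Complex.measurable_exp.comp h3.neg
  -- The disc of radius `1` about `1` lies in the right half-plane; this is what gives `‖v‖ ≤ 1`.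
  have hgre : ∀ r, 0 ≤ (g r).re := fun r => by
    have := (Complex.re_le_norm _).trans (hgn r)
    simp at this
    exact this
  have hv1 : ∀ s, ‖v s‖ ≤ 1 := fun s => by
    rw [hv, Complex.norm_exp, Real.exp_le_one_iff, Complex.neg_re, neg_nonpos]
    -- Integrability is only available for `s ≥ 0`. Where it fails, the integral takes the default
    -- value `0` and `v s = 1`.
    by_cases hi : IntegrableOn g (Ioi s)
    · have : (∫ r in Ioi s, g r).re = ∫ r in Ioi s, (g r).re := (integral_re hi).symm
      rw [this]
      exact integral_nonneg fun r => hgre r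
    · rw [integral_undef hi]
      simp
  have hfix : ∀ s, 0 ≤ s →
      ∫ z, Φ (s + z.1, z.2) * v (s + z.1) ∂((expMeasure 1).prod H) = v s := by
    intro s hs
    rw [integral_prod]
    · simp_rw [integral_mul_const]
      refine Eq.trans ?_ (integral_exp_renewal hgm hgn hgi hs)
      refine integral_congr_ae (ae_of_all _ fun t => ?_)
      simp only
      rw [hg1]
    · refine (integrable_const (1 : ℝ)).mono' ?_ (ae_of_all _ fun z => ?_)
      · have : Measurable fun z : ℝ × 𝒲 => (s + z.1, z.2) := by fun_prop
        exact ((hΦ.comp this).mul (hvm.comp (by fun_prop))).aestronglyMeasurable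
      · rw [norm_mul]
        exact mul_le_one₀ (hΦ1 _) (norm_nonneg _) (hv1 _)
  have hvlim : Tendsto v atTop (𝓝 1) := by
    have h1 : Tendsto (fun s => ∫ r in Ioi s, g r) atTop (𝓝 0) := by
      have h2 := intervalIntegral_tendsto_integral_Ioi 0 hgi tendsto_id
      have h3 := (tendsto_const_nhds (x := ∫ r in Ioi 0, g r)).sub h2
      rw [sub_self] at h3
      refine h3.congr' ?_
      filter_upwards [eventually_ge_atTop 0] with s hs
      rw [sub_eq_iff_eq_add', id, intervalIntegral.integral_interval_add_Ioi hgi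
        (hgi.mono_set (Ioi_subset_Ioi hs))]
    have := (Complex.continuous_exp.tendsto _).comp h1.neg
    simpa [hv, Function.comp_def] using this
  have hRm : ∀ n, Measurable fun ω => ∏ k ∈ Finset.Ico K (K + n), Φ (arrival E (k + 1) ω, W k ω) :=
    fun n => Finset.measurable_prod _ fun k _ =>
      hΦ.comp ((h.measurable_arrival _).prodMk (h.measurable_W k))
  have hR1 : ∀ n ω, ‖∏ k ∈ Finset.Ico K (K + n), Φ (arrival E (k + 1) ω, W k ω)‖ ≤ 1 := fun n ω => by
    rw [norm_prod]
    exact Finset.prod_le_one (fun _ _ => norm_nonneg _) fun _ _ => hΦ1 _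
  have hva : ∀ n, Measurable fun ω => v (arrival E n ω) := fun n =>
    hvm.comp (h.measurable_arrival n)
  -- The error made by dropping the factor `v` at the last arrival tends to zero: the products stay
  -- in the unit disc while `v(Γ_{K+n}) → 1` almost surely.
  have hzero : Tendsto (fun n => ∫ ω, (∏ k ∈ Finset.Ico K (K + n), Φ (arrival E (k + 1) ω, W k ω)) *
      (v (arrival E (K + n) ω) - 1) ∂P) atTop (𝓝 (∫ _, 0 ∂P)) := by
    refine tendsto_integral_of_dominated_convergence (fun _ => 2)
      (fun n => ((hRm n).mul ((hva _).sub measurable_const)).aestronglyMeasurable)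
      (integrable_const _) (fun n => ae_of_all _ fun ω => ?_) ?_
    · rw [norm_mul]
      refine (mul_le_of_le_one_left (norm_nonneg _) (hR1 n ω)).trans ?_
      refine (norm_sub_le _ _).trans ?_
      have := hv1 (arrival E (K + n) ω)
      rw [norm_one]
      linarith
    · filter_upwards [h.tendsto_arrival] with ω hω
      have h1 : Tendsto (fun n => v (arrival E (K + n) ω) - 1) atTop (𝓝 0) := by
        have := (hvlim.comp (hω.comp (tendsto_add_atTop_nat K))).sub_const 1
        simpa [Function.comp_def, add_comm] using this
      refine squeeze_zero_norm (fun n => ?_) (tendsto_zero_iff_norm_tendsto_zero.1 h1)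
      rw [norm_mul]
      exact mul_le_of_le_one_left (norm_nonneg _) (hR1 n ω)
  have hdiff : ∀ n, ∫ ω, ∏ k ∈ Finset.Ico K (K + n), Φ (arrival E (k + 1) ω, W k ω) ∂P =
      (∫ ω, v (arrival E K ω) ∂P) -
        ∫ ω, (∏ k ∈ Finset.Ico K (K + n), Φ (arrival E (k + 1) ω, W k ω)) *
          (v (arrival E (K + n) ω) - 1) ∂P := by
    intro n
    rw [← h.integral_prod_mul hΦ hΦ1 hvm hv1 hfix K n, ← integral_sub]
    · refine integral_congr_ae (ae_of_all _ fun ω => ?_)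
      simp only
      ring
    · refine (integrable_const (1 : ℝ)).mono' ((hRm n).mul (hva _)).aestronglyMeasurable
        (ae_of_all _ fun ω => ?_)
      rw [norm_mul]
      exact mul_le_one₀ (hR1 n ω) (norm_nonneg _) (hv1 _)
    · refine (integrable_const (2 : ℝ)).mono'
        ((hRm n).mul ((hva _).sub measurable_const)).aestronglyMeasurable (ae_of_all _ fun ω => ?_)
      rw [norm_mul]
      refine (mul_le_of_le_one_left (norm_nonneg _) (hR1 n ω)).trans ?_
      refine (norm_sub_le _ _).trans ?_
      have := hv1 (arrival E (K + n) ω)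
      rw [norm_one]
      linarith
  simp_rw [hdiff]
  have := (tendsto_const_nhds (x := ∫ ω, v (arrival E K ω) ∂P)).sub hzero
  simpa using this

end Arrivals
end TruncRM
namespace TruncRM
open Filter Topology

/-! ### Poisson process laws through characteristic functions -/

theorem charFun_map_toLp_pi {Ω ι : Type*} [MeasurableSpace Ω] [Fintype ι] {P : Measure Ω}
    {Z : ι → Ω → ℝ} (hZ : ∀ i, AEMeasurable (Z i) P) (t : EuclideanSpace ℝ ι) :
    charFun (P.map (fun ω => WithLp.toLp 2 (Z · ω))) t =
      ∫ ω, Complex.exp ((∑ i, t i * Z i ω : ℝ) * Complex.I) ∂P := by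
  have hm : AEMeasurable (fun ω => WithLp.toLp 2 (Z · ω)) P := by
    have : AEMeasurable (fun ω => (Z · ω)) P := aemeasurable_pi_lambda _ hZ
    fun_prop
  rw [charFun_apply, integral_map hm (by fun_prop)]
  simp [PiLp.inner_apply]

/-- Independence is a factorisation of the joint characteristic function. Dominated convergence
passes both sides to the limit. -/
theorem iIndepFun_of_tendsto {Ω ι : Type*} [MeasurableSpace Ω] [Fintype ι] {P : Measure Ω}
    [IsProbabilityMeasure P] {X : ι → Ω → ℝ} {Y : ℕ → ι → Ω → ℝ}
    (hX : ∀ i, AEMeasurable (X i) P) (hY : ∀ m i, AEMeasurable (Y m i) P)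
    (hlim : ∀ i, ∀ᵐ ω ∂P, Tendsto (fun m => Y m i ω) atTop (𝓝 (X i ω)))
    (hind : ∀ m, iIndepFun (Y m) P) : iIndepFun X P := by
  have hone : ∀ Z : Ω → ℝ, AEMeasurable Z P → ∀ t : ℝ,
      charFun (P.map Z) t = ∫ ω, Complex.exp ((Z ω * t : ℝ) * Complex.I) ∂P := by
    intro Z hZ t
    rw [charFun_apply, integral_map hZ (by fun_prop)]
    simp [mul_comm]
  rw [iIndepFun_iff_charFun_pi hX]
  intro t
  have hnorm : ∀ r : ℝ, ‖Complex.exp ((r : ℂ) * Complex.I)‖ ≤ 1 := fun r =>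
    (Complex.norm_exp_ofReal_mul_I r).le
  have h1 : Tendsto (fun m => charFun (P.map (fun ω => WithLp.toLp 2 (Y m · ω))) t) atTop
      (𝓝 (charFun (P.map (fun ω => WithLp.toLp 2 (X · ω))) t)) := by
    simp_rw [charFun_map_toLp_pi (hY _) t, charFun_map_toLp_pi hX t]
    refine tendsto_integral_of_dominated_convergence (fun _ => 1) (fun m => ?_)
      (integrable_const _) (fun m => ae_of_all _ fun ω => hnorm _) ?_
    · have : AEMeasurable (fun ω => ∑ i, t i * Y m i ω) P :=
        Finset.aemeasurable_fun_sum _ fun i _ => (hY m i).const_mul _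
      exact (by fun_prop : AEMeasurable (fun ω => Complex.exp ((∑ i, t i * Y m i ω : ℝ) *
        Complex.I)) P).aestronglyMeasurable
    · filter_upwards [ae_all_iff.2 hlim] with ω hω
      have h2 : Tendsto (fun m => ∑ i, t i * Y m i ω) atTop (𝓝 (∑ i, t i * X i ω)) :=
        tendsto_finsetSum _ fun i _ => (hω i).const_mul _
      exact ((by fun_prop : Continuous fun r : ℝ => Complex.exp ((r : ℂ) *
        Complex.I)).tendsto _).comp h2
  have h2 : ∀ i, Tendsto (fun m => charFun (P.map (Y m i)) (t i)) atTop
      (𝓝 (charFun (P.map (X i)) (t i))) := by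
    intro i
    simp_rw [hone _ (hY _ i) (t i), hone _ (hX i) (t i)]
    refine tendsto_integral_of_dominated_convergence (fun _ => 1) (fun m => ?_)
      (integrable_const _) (fun m => ae_of_all _ fun ω => hnorm _) ?_
    · have := hY m i
      exact (by fun_prop : AEMeasurable (fun ω => Complex.exp ((Y m i ω * t i : ℝ) *
        Complex.I)) P).aestronglyMeasurable
    · filter_upwards [hlim i] with ω hω
      exact ((by fun_prop : Continuous fun r : ℝ => Complex.exp ((r : ℂ) *
        Complex.I)).tendsto _).comp (hω.mul_const _)
  refine tendsto_nhds_unique h1 ?_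
  refine (tendsto_finsetProd Finset.univ fun i _ => h2 i).congr fun m => ?_
  exact ((iIndepFun_iff_charFun_pi (hY m)).1 (hind m) t).symm

theorem iIndepFun_ennreal_of_tendsto {Ω ι : Type*} [MeasurableSpace Ω] [Fintype ι] {P : Measure Ω}
    [IsProbabilityMeasure P] {X : ι → Ω → ℝ≥0∞} {Y : ℕ → ι → Ω → ℝ≥0∞}
    (hX : ∀ i, Measurable (X i)) (hY : ∀ m i, Measurable (Y m i))
    (hlim : ∀ i ω, Tendsto (fun m => Y m i ω) atTop (𝓝 (X i ω)))
    (hind : ∀ m, iIndepFun (Y m) P) : iIndepFun X P := by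
  -- A continuous injection of `[0, ∞]` into the reals that sends `∞` to `0`, with measurable left
  -- inverse `σ`; it reduces the extended case to the real one.
  let τ : ℝ≥0∞ → ℝ := fun x => ((x + 1)⁻¹).toReal
  let σ : ℝ → ℝ≥0∞ := fun r => (ENNReal.ofReal r)⁻¹ - 1
  have hτ : Measurable τ := by fun_prop
  have hσ : Measurable σ := by fun_prop
  have hne : ∀ x : ℝ≥0∞, (x + 1)⁻¹ ≠ ∞ := fun x => by simp
  have hστ : ∀ x, σ (τ x) = x := fun x => by
    simp only [σ, τ, ENNReal.ofReal_toReal (hne x), inv_inv]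
    exact ENNReal.add_sub_cancel_right ENNReal.one_ne_top
  have h : iIndepFun (fun i => τ ∘ X i) P := by
    refine iIndepFun_of_tendsto (Y := fun m i => τ ∘ Y m i)
      (fun i => (hτ.comp (hX i)).aemeasurable) (fun m i => (hτ.comp (hY m i)).aemeasurable)
      (fun i => ae_of_all _ fun ω => ?_) fun m => (hind m).comp _ fun _ => hτ
    have h1 : Tendsto (fun m => (Y m i ω + 1)⁻¹) atTop (𝓝 (X i ω + 1)⁻¹) :=
      tendsto_inv_iff.2 ((hlim i ω).add tendsto_const_nhds)
    exact (ENNReal.tendsto_toReal (hne _)).comp h1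
  convert h.comp (fun _ => σ) (fun _ => hσ) using 2 with i
  funext ω
  exact (hστ _).symm

/-- The joint characteristic function of the values of a Poisson process on disjoint sets of finite
rate. -/
structure HasPoissonCharFun {E : Type*} [MeasurableSpace E] (Q : Measure (Measure E))
    (μ : Measure E) : Prop where
  finite : ∀ A : Set E, MeasurableSet A → μ A ≠ ∞ → ∀ᵐ M ∂Q, M A ≠ ∞
  integral_cexp : ∀ (n : ℕ) (A : Fin n → Set E), (∀ i, MeasurableSet (A i)) →
    (∀ i, μ (A i) ≠ ∞) → Pairwise (fun i j => Disjoint (A i) (A j)) → ∀ t : Fin n → ℝ,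
    ∫ M, Complex.exp ((∑ i, t i * (M (A i)).toReal : ℝ) * Complex.I) ∂Q =
      Complex.exp (∑ i, (μ (A i)).toReal * (Complex.exp (t i * Complex.I) - 1))

theorem charFun_map_toReal {Ω : Type*} [MeasurableSpace Ω] {Q : Measure Ω} {X : Ω → ℝ≥0∞}
    (hX : Measurable X) (t : ℝ) :
    charFun (Q.map fun M => (X M).toReal) t =
      ∫ M, Complex.exp ((t * (X M).toReal : ℝ) * Complex.I) ∂Q := by
  rw [charFun_apply, integral_map (by fun_prop) (by fun_prop)]
  simp

/-- On sets of finite rate, counts and independence can be read off from the joint characteristic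
function. A set of infinite rate is exhausted by its intersections with the spanning sets of `μ`,
and independence survives this monotone limit. -/
theorem HasPoissonCharFun.isPoissonProcessLaw {E : Type*} [MeasurableSpace E]
    {Q : Measure (Measure E)} [IsProbabilityMeasure Q] {μ : Measure E} [SigmaFinite μ]
    (h : HasPoissonCharFun Q μ) : IsPoissonProcessLaw Q μ := by
  have hm : ∀ A : Set E, MeasurableSet A → Measurable fun M : Measure E => M A :=
    fun A hA => Measure.measurable_coe hA
  have hone : ∀ A : Set E, MeasurableSet A → μ A ≠ ∞ → ∀ t : ℝ,
      charFun (Q.map fun M => (M A).toReal) t =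
        Complex.exp ((μ A).toReal * (Complex.exp (t * Complex.I) - 1)) := by
    intro A hA hAf t
    rw [charFun_map_toReal (hm A hA)]
    simpa using h.integral_cexp 1 (fun _ => A) (fun _ => hA) (fun _ => hAf)
      (fun i j hij => (hij (Subsingleton.elim i j)).elim) (fun _ => t)
  refine ⟨fun A hA hAf => ?_, fun n A hA hdisj => ?_⟩
  · have h1 : Q.map (fun M => (M A).toReal) =
        (poissonMeasure (μ A).toNNReal).map (fun n : ℕ => (n : ℝ)) := by
      have := Measure.isProbabilityMeasure_map (μ := Q)
        (f := fun M => (M A).toReal) (hm A hA).ennreal_toReal.aemeasurable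
      have := Measure.isProbabilityMeasure_map (μ := poissonMeasure (μ A).toNNReal)
        (f := fun n : ℕ => (n : ℝ)) .of_discrete
      refine Measure.ext_of_charFun (funext fun t => ?_)
      rw [hone A hA hAf t, charFun_map_cast_poissonMeasure]
      rfl
    have h2 := congrArg (Measure.map ENNReal.ofReal) h1
    rw [Measure.map_map (by fun_prop) (hm A hA).ennreal_toReal,
      Measure.map_map (by fun_prop) .of_discrete] at h2
    simp only [Function.comp_def, ENNReal.ofReal_natCast] at h2
    rw [← h2]
    refine Measure.map_congr ?_
    filter_upwards [h.finite A hA hAf] with M hM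
    exact (ENNReal.ofReal_toReal hM).symm
  · refine iIndepFun_ennreal_of_tendsto
      (Y := fun m i (M : Measure E) => M (A i ∩ spanningSets μ m)) (fun i => hm _ (hA i))
      (fun m i => hm _ ((hA i).inter (measurableSet_spanningSets μ m))) (fun i M => ?_) fun m => ?_
    · have h1 := tendsto_measure_iUnion_atTop (μ := M) (s := fun m => A i ∩ spanningSets μ m)
        (fun a b hab => inter_subset_inter_right _ (monotone_spanningSets μ hab))
      rwa [← inter_iUnion, iUnion_spanningSets, inter_univ] at h1
    · set B : Fin n → Set E := fun i => A i ∩ spanningSets μ m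
      have hB : ∀ i, MeasurableSet (B i) := fun i =>
        (hA i).inter (measurableSet_spanningSets μ m)
      have hBf : ∀ i, μ (B i) ≠ ∞ := fun i =>
        ((measure_mono inter_subset_right).trans_lt (measure_spanningSets_lt_top μ m)).ne
      have hBd : Pairwise (fun i j => Disjoint (B i) (B j)) := fun i j hij =>
        (hdisj hij).mono inter_subset_left inter_subset_left
      have h1 : iIndepFun (fun (i : Fin n) (M : Measure E) => (M (B i)).toReal) Q := by
        rw [iIndepFun_iff_charFun_pi (fun i => (hm _ (hB i)).ennreal_toReal.aemeasurable)]
        intro t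
        rw [charFun_map_toLp_pi fun i => (hm _ (hB i)).ennreal_toReal.aemeasurable]
        simp_rw [hone _ (hB _) (hBf _)]
        rw [← Complex.exp_sum, ← h.integral_cexp n B hB hBf hBd]
      have h2 := h1.comp (fun _ => ENNReal.ofReal) fun _ => by fun_prop
      refine h2.congr fun i => ?_
      filter_upwards [h.finite _ (hB i) (hBf i)] with M hM
      exact ENNReal.ofReal_toReal hM

/-- Normalisation is not a separate field: independence of the empty family already forces total
mass one. -/
theorem IsPoissonProcessLaw.isProbabilityMeasure {E : Type*} [MeasurableSpace E]
    {Q : Measure (Measure E)} {μ : Measure E} (h : IsPoissonProcessLaw Q μ) :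
    IsProbabilityMeasure Q :=
  (h.indep 0 (fun _ => ∅) (fun _ => .empty) fun i => i.elim0).isProbabilityMeasure

theorem IsPoissonProcessLaw.hasPoissonCharFun {E : Type*} [MeasurableSpace E]
    {Q : Measure (Measure E)} {μ : Measure E} (h : IsPoissonProcessLaw Q μ) :
    HasPoissonCharFun Q μ := by
  have := h.isProbabilityMeasure
  have hm : ∀ A : Set E, MeasurableSet A → Measurable fun M : Measure E => M A :=
    fun A hA => Measure.measurable_coe hA
  refine ⟨fun A hA hAf => ?_, fun n A hA hAf hdisj t => ?_⟩
  · refine ae_of_ae_map (p := fun x => x ≠ ∞) (hm A hA).aemeasurable ?_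
    rw [h.count A hA hAf, ae_map_iff .of_discrete (by measurability)]
    exact ae_of_all _ fun n => ENNReal.natCast_ne_top n
  · have h1 := (h.indep n A hA hdisj).comp (fun _ => ENNReal.toReal) fun _ => by fun_prop
    have h2 := (iIndepFun_iff_charFun_pi
      (fun i => (hm _ (hA i)).ennreal_toReal.aemeasurable)).1 h1 (WithLp.toLp 2 t)
    rw [charFun_map_toLp_pi fun i => (hm _ (hA i)).ennreal_toReal.aemeasurable] at h2
    rw [Complex.exp_sum]
    refine h2.trans (Finset.prod_congr rfl fun i _ => ?_)
    · have h3 : Q.map (ENNReal.toReal ∘ fun M => M (A i)) =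
          (poissonMeasure (μ (A i)).toNNReal).map (fun n : ℕ => (n : ℝ)) := by
        rw [← Measure.map_map (by fun_prop) (hm _ (hA i)), h.count _ (hA i) (hAf i),
          Measure.map_map (by fun_prop) .of_discrete]
        simp [Function.comp_def]
      refine Eq.trans (congrArg (fun ν => charFun ν (t i)) h3) ?_
      rw [charFun_map_cast_poissonMeasure]
      rfl

/-- Superposition of independent Poisson processes. -/
theorem IsPoissonProcessLaw.add {E : Type*} [MeasurableSpace E] {Q₁ Q₂ : Measure (Measure E)}
    {μ₁ μ₂ : Measure E} [SigmaFinite (μ₁ + μ₂)] (h₁ : IsPoissonProcessLaw Q₁ μ₁)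
    (h₂ : IsPoissonProcessLaw Q₂ μ₂) :
    IsPoissonProcessLaw ((Q₁.prod Q₂).map fun M => M.1 + M.2) (μ₁ + μ₂) := by
  have := h₁.isProbabilityMeasure
  have := h₂.isProbabilityMeasure
  have hm : ∀ A : Set E, MeasurableSet A → Measurable fun M : Measure E => M A :=
    fun A hA => Measure.measurable_coe hA
  have hadd : Measurable fun M : Measure E × Measure E => M.1 + M.2 := by
    refine Measure.measurable_of_measurable_coe _ fun A hA => ?_
    simp only [Measure.add_apply]
    exact ((hm A hA).comp measurable_fst).add ((hm A hA).comp measurable_snd)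
  have := Measure.isProbabilityMeasure_map (μ := Q₁.prod Q₂) hadd.aemeasurable
  have hc₁ := h₁.hasPoissonCharFun
  have hc₂ := h₂.hasPoissonCharFun
  refine HasPoissonCharFun.isPoissonProcessLaw ⟨fun A hA hAf => ?_, fun n A hA hAf hdisj t => ?_⟩
  · rw [Measure.add_apply, ENNReal.add_ne_top] at hAf
    refine (ae_map_iff hadd.aemeasurable (p := fun M => M A ≠ ∞)
      (measurableSet_eq_fun (hm A hA) measurable_const).compl).2 ?_
    have e1 : ∀ᵐ M ∂(Q₁.prod Q₂), M.1 A ≠ ∞ :=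
      Measure.quasiMeasurePreserving_fst.ae (hc₁.finite A hA hAf.1)
    have e2 : ∀ᵐ M ∂(Q₁.prod Q₂), M.2 A ≠ ∞ :=
      Measure.quasiMeasurePreserving_snd.ae (hc₂.finite A hA hAf.2)
    filter_upwards [e1, e2] with M h1 h2
    simp [h1, h2]
  · have hAf' : ∀ i, μ₁ (A i) ≠ ∞ ∧ μ₂ (A i) ≠ ∞ := fun i => by
      have := hAf i
      rwa [Measure.add_apply, ENNReal.add_ne_top] at this
    have hfm : Measurable fun M : Measure E =>
        Complex.exp ((∑ i, t i * (M (A i)).toReal : ℝ) * Complex.I) := by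
      have : Measurable fun M : Measure E => ∑ i, t i * (M (A i)).toReal :=
        Finset.measurable_fun_sum _ fun i _ => (hm _ (hA i)).ennreal_toReal.const_mul _
      fun_prop
    rw [integral_map hadd.aemeasurable hfm.aestronglyMeasurable]
    have e1 : ∀ᵐ M ∂(Q₁.prod Q₂), ∀ i, M.1 (A i) ≠ ∞ := ae_all_iff.2 fun i =>
      Measure.quasiMeasurePreserving_fst.ae (hc₁.finite _ (hA i) (hAf' i).1)
    have e2 : ∀ᵐ M ∂(Q₁.prod Q₂), ∀ i, M.2 (A i) ≠ ∞ := ae_all_iff.2 fun i =>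
      Measure.quasiMeasurePreserving_snd.ae (hc₂.finite _ (hA i) (hAf' i).2)
    have hsplit : ∀ᵐ M ∂(Q₁.prod Q₂),
        Complex.exp ((∑ i, t i * ((M.1 + M.2) (A i)).toReal : ℝ) * Complex.I) =
        Complex.exp ((∑ i, t i * (M.1 (A i)).toReal : ℝ) * Complex.I) *
          Complex.exp ((∑ i, t i * (M.2 (A i)).toReal : ℝ) * Complex.I) := by
      filter_upwards [e1, e2] with M h1 h2
      rw [← Complex.exp_add, ← add_mul, ← Complex.ofReal_add, ← Finset.sum_add_distrib]
      simp_rw [Measure.add_apply, ENNReal.toReal_add (h1 _) (h2 _), mul_add]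
    rw [integral_congr_ae hsplit, integral_prod_mul
      (fun M : Measure E => Complex.exp ((∑ i, t i * (M (A i)).toReal : ℝ) * Complex.I))
      (fun M : Measure E => Complex.exp ((∑ i, t i * (M (A i)).toReal : ℝ) * Complex.I)),
      hc₁.integral_cexp n A hA (fun i => (hAf' i).1) hdisj,
      hc₂.integral_cexp n A hA (fun i => (hAf' i).2) hdisj, ← Complex.exp_add,
      ← Finset.sum_add_distrib]
    congr 1
    refine Finset.sum_congr rfl fun i _ => ?_
    rw [Measure.add_apply, ENNReal.toReal_add (hAf' i).1 (hAf' i).2]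
    push_cast
    ring

end TruncRM
namespace TruncRM
open Filter Topology

/-! ### Poisson processes from sequences of random points -/

/-- The function `e ↦ exp(i t_j)` on `A j`, equal to `1` outside of `⋃ j, A j`. -/
noncomputable def phaseFn {E : Type*} {n : ℕ} (A : Fin n → Set E) (t : Fin n → ℝ) (e : E) : ℂ :=
  1 + ∑ i, (A i).indicator (fun _ => Complex.exp (t i * Complex.I) - 1) e

section Phase

variable {E : Type*} {n : ℕ} {A : Fin n → Set E}

/-- By disjointness at most one indicator is nonzero. The additive form is the one to integrate; the
exponential form turns products over points into characteristic functions of counts. -/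
theorem phaseFn_eq (hdisj : Pairwise (fun i j => Disjoint (A i) (A j))) (t : Fin n → ℝ) (e : E) :
    phaseFn A t e =
      Complex.exp ((∑ i, t i * (A i).indicator (fun _ => (1 : ℝ)) e : ℝ) * Complex.I) := by
  unfold phaseFn
  by_cases h : ∃ j, e ∈ A j
  · obtain ⟨j, hj⟩ := h
    have hne : ∀ i, i ≠ j → e ∉ A i := fun i hi he => disjoint_left.1 (hdisj hi) he hj
    rw [Finset.sum_eq_single j (fun i _ hi => indicator_of_notMem (hne i hi) _) (by simp),
      Finset.sum_eq_single j (fun i _ hi => by rw [indicator_of_notMem (hne i hi), mul_zero])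
        (by simp), indicator_of_mem hj, indicator_of_mem hj]
    simp
  · push Not at h
    simp [h]

theorem prod_phaseFn (hdisj : Pairwise (fun i j => Disjoint (A i) (A j))) (t : Fin n → ℝ)
    (s : Finset ℕ) (x : ℕ → E) :
    ∏ k ∈ s, phaseFn A t (x k) = Complex.exp
      ((∑ i, t i * ∑ k ∈ s, (A i).indicator (fun _ => (1 : ℝ)) (x k) : ℝ) * Complex.I) := by
  simp_rw [phaseFn_eq hdisj, ← Complex.exp_sum, ← Finset.sum_mul, ← Complex.ofReal_sum]
  rw [Finset.sum_comm]
  simp_rw [Finset.mul_sum]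

theorem norm_phaseFn (hdisj : Pairwise (fun i j => Disjoint (A i) (A j))) (t : Fin n → ℝ) (e : E) :
    ‖phaseFn A t e‖ = 1 := by
  rw [phaseFn_eq hdisj, Complex.norm_exp_ofReal_mul_I]

variable [MeasurableSpace E]

theorem measurable_phaseFn (hA : ∀ i, MeasurableSet (A i)) (t : Fin n → ℝ) :
    Measurable (phaseFn A t) :=
  measurable_const.add (Finset.measurable_sum _ fun i _ => measurable_const.indicator (hA i))

theorem integrable_one_sub_phaseFn {μ : Measure E} (hA : ∀ i, MeasurableSet (A i))
    (hAf : ∀ i, μ (A i) ≠ ∞) (t : Fin n → ℝ) : Integrable (fun e => 1 - phaseFn A t e) μ := by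
  simp only [phaseFn, sub_add_cancel_left]
  exact (integrable_finsetSum _ fun i _ =>
    (integrable_indicator_iff (hA i)).2 (integrableOn_const (hAf i))).neg

theorem integral_one_sub_phaseFn {μ : Measure E} (hA : ∀ i, MeasurableSet (A i))
    (hAf : ∀ i, μ (A i) ≠ ∞) (t : Fin n → ℝ) :
    ∫ e, (1 - phaseFn A t e) ∂μ =
      -∑ i, (μ (A i)).toReal * (Complex.exp (t i * Complex.I) - 1) := by
  simp only [phaseFn, sub_add_cancel_left]
  rw [integral_neg, integral_finsetSum _ fun i _ =>
    (integrable_indicator_iff (hA i)).2 (integrableOn_const (hAf i))]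
  congr 1
  refine Finset.sum_congr rfl fun i _ => ?_
  rw [integral_indicator (hA i), setIntegral_const]
  simp [Measure.real]

end Phase

section Points

variable {Ω E : Type*} [MeasurableSpace Ω] [MeasurableSpace E] {P : Measure Ω}

theorem measurable_sum_dirac {e : ℕ → Ω → E} (he : ∀ k, Measurable (e k)) :
    Measurable fun ω => Measure.sum fun k => Measure.dirac (e k ω) := by
  refine Measure.measurable_of_measurable_coe _ fun A hA => ?_
  simp only [Measure.sum_apply _ hA, Measure.dirac_apply' _ hA]
  exact Measurable.tsum fun k => (measurable_const.indicator hA).comp (he k)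

/-- Applying the exponential formula to `phaseFn` gives the characteristic function once the counts
are known to be finite. Finiteness comes from the same formula, through the generating function of
the count as its argument tends to `1`. -/
theorem hasPoissonCharFun_of_tendsto [IsProbabilityMeasure P] {e : ℕ → Ω → E}
    (he : ∀ k, Measurable (e k)) {μ : Measure E}
    (h : ∀ φ : E → ℂ, Measurable φ → (∀ x, ‖φ x‖ ≤ 1) → Integrable (fun x => 1 - φ x) μ →
      Tendsto (fun n => ∫ ω, ∏ k ∈ Finset.range n, φ (e k ω) ∂P) atTop
        (𝓝 (Complex.exp (-∫ x, (1 - φ x) ∂μ)))) :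
    HasPoissonCharFun (P.map fun ω => Measure.sum fun k => Measure.dirac (e k ω)) μ := by
  have hN := measurable_sum_dirac he
  set N : Ω → Measure E := fun ω => Measure.sum fun k => Measure.dirac (e k ω) with hNdef
  have hm : ∀ A : Set E, MeasurableSet A → Measurable fun M : Measure E => M A :=
    fun A hA => Measure.measurable_coe hA
  have hNA : ∀ A : Set E, MeasurableSet A → ∀ ω,
      Tendsto (fun n => ∑ k ∈ Finset.range n, A.indicator (1 : E → ℝ≥0∞) (e k ω)) atTop
        (𝓝 (N ω A)) := by
    intro A hA ω
    rw [hNdef]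
    simp only [Measure.sum_apply _ hA, Measure.dirac_apply' _ hA]
    exact ENNReal.tendsto_nat_tsum _
  have hfin : ∀ A : Set E, MeasurableSet A → μ A ≠ ∞ → ∀ᵐ ω ∂P, N ω A ≠ ∞ := by
    intro A hA hAf
    classical
    set B : Set Ω := {ω | N ω A ≠ ∞} with hB
    have hBm : MeasurableSet B := (measurableSet_eq_fun ((hm A hA).comp hN) measurable_const).compl
    set c : ℕ → Ω → ℕ := fun n ω => ((Finset.range n).filter fun k => e k ω ∈ A).card with hc
    have hcm : ∀ n, Measurable (c n) := fun n => by
      simp only [hc, Finset.card_filter]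
      exact Finset.measurable_fun_sum _ fun k _ =>
        Measurable.ite (he k hA) measurable_const measurable_const
    have hcN : ∀ ω, Tendsto (fun n => (c n ω : ℝ≥0∞)) atTop (𝓝 (N ω A)) := fun ω => by
      refine (hNA A hA ω).congr fun n => ?_
      simp [hc, indicator_apply]
    -- The test function equals `s` on `A` and `1` elsewhere, so its product over the first `n`
    -- points is `s ^ c n`. Where the count is infinite this tends to `0`, so only `B` contributes
    -- to the limit; letting `s ↑ 1` then gives full mass.
    have key : ∀ s : ℝ, 0 ≤ s → s < 1 → Real.exp (-((1 - s) * μ.real A)) ≤ P.real B := by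
      intro s hs0 hs1
      set φ : E → ℂ := fun x => 1 - A.indicator (fun _ => ((1 - s : ℝ) : ℂ)) x with hφ
      have hφm : Measurable φ := measurable_const.sub (measurable_const.indicator hA)
      have hφv : ∀ x, φ x = ((if x ∈ A then s else 1 : ℝ) : ℂ) := fun x => by
        by_cases hx : x ∈ A <;> simp [hφ, hx]
      have hφ1 : ∀ x, ‖φ x‖ ≤ 1 := fun x => by
        rw [hφv, Complex.norm_real]
        split_ifs
        · rw [Real.norm_of_nonneg hs0]; exact hs1.le
        · simp
      have hφi : Integrable (fun x => 1 - φ x) μ := by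
        simp only [hφ, sub_sub_cancel]
        exact (integrable_indicator_iff hA).2 (integrableOn_const hAf)
      have h1 := h φ hφm hφ1 hφi
      have h2 : ∫ x, (1 - φ x) ∂μ = (((1 - s) * μ.real A : ℝ) : ℂ) := by
        simp only [hφ, sub_sub_cancel]
        rw [integral_indicator hA, setIntegral_const]
        simp [mul_comm]
      have h3 : ∀ n, ∫ ω, ∏ k ∈ Finset.range n, φ (e k ω) ∂P =
          ((∫ ω, s ^ c n ω ∂P : ℝ) : ℂ) := fun n => by
        rw [← integral_complex_ofReal]
        refine integral_congr_ae (ae_of_all _ fun ω => ?_)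
        simp only [hφv, hc]
        rw [← Complex.ofReal_prod, Finset.prod_ite]
        simp
      simp_rw [h3] at h1
      rw [h2, ← Complex.ofReal_neg, ← Complex.ofReal_exp] at h1
      have h4 : Tendsto (fun n => ∫ ω, s ^ c n ω ∂P) atTop
          (𝓝 (Real.exp (-((1 - s) * μ.real A)))) := by
        have := (Complex.continuous_re.tendsto _).comp h1
        simpa only [Function.comp_def, Complex.ofReal_re] using this
      have hsm : ∀ n, Measurable fun ω => s ^ c n ω := fun n =>
        (measurable_from_top (f := fun m : ℕ => s ^ m)).comp (hcm n)
      have hsb : ∀ n ω, ‖s ^ c n ω‖ ≤ 1 := fun n ω => by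
        rw [Real.norm_of_nonneg (pow_nonneg hs0 _)]
        exact pow_le_one₀ hs0 hs1.le
      have hsi : ∀ n, Integrable (fun ω => s ^ c n ω) P := fun n =>
        (integrable_const (1 : ℝ)).mono' (hsm n).aestronglyMeasurable (ae_of_all _ (hsb n))
      have h5 : Tendsto (fun n => ∫ ω in Bᶜ, s ^ c n ω ∂P) atTop (𝓝 (∫ _ in Bᶜ, 0 ∂P)) := by
        refine tendsto_integral_of_dominated_convergence (fun _ => 1)
          (fun n => (hsm n).aestronglyMeasurable) (integrable_const _)
          (fun n => ae_of_all _ (hsb n)) ?_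
        filter_upwards [ae_restrict_mem hBm.compl] with ω hω
        have hω' : N ω A = ∞ := by simpa [hB] using hω
        have h6 := hcN ω
        rw [hω', ENNReal.tendsto_nhds_top_iff_nat] at h6
        refine (tendsto_pow_atTop_nhds_zero_of_lt_one hs0 hs1).comp (tendsto_atTop.2 fun m => ?_)
        filter_upwards [h6 m] with n hn
        exact_mod_cast hn.le
      rw [integral_zero] at h5
      have h7 := (tendsto_const_nhds (x := P.real B)).add h5
      rw [add_zero] at h7
      refine le_of_tendsto_of_tendsto' h4 h7 fun n => ?_
      rw [← integral_add_compl hBm (hsi n)]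
      gcongr
      have : ∫ ω in B, s ^ c n ω ∂P ≤ ∫ _ in B, (1 : ℝ) ∂P :=
        integral_mono (hsi n).integrableOn (integrable_const _) fun ω => pow_le_one₀ hs0 hs1.le
      simpa using this
    have hle : (1 : ℝ) ≤ P.real B := by
      have hc1 : Continuous fun s : ℝ => Real.exp (-((1 - s) * μ.real A)) := by fun_prop
      have h8 : Tendsto (fun s : ℝ => Real.exp (-((1 - s) * μ.real A))) (𝓝[<] 1) (𝓝 1) := by
        have := (hc1.tendsto 1).mono_left (nhdsWithin_le_nhds (s := Iio 1))
        simpa using this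
      refine le_of_tendsto h8 ?_
      filter_upwards [self_mem_nhdsWithin,
        mem_nhdsWithin_of_mem_nhds (Ioi_mem_nhds (zero_lt_one' ℝ))] with s h1 h2
      exact key s (le_of_lt h2) h1
    have hP1 : P.real B = 1 := le_antisymm measureReal_le_one hle
    have : P B = 1 := by
      rw [← ENNReal.ofReal_toReal (measure_ne_top P B)]
      simp [← measureReal_def, hP1]
    exact (mem_ae_iff_prob_eq_one hBm).2 this
  refine ⟨fun A hA hAf => ?_, fun n A hA hAf hdisj t => ?_⟩
  · exact (ae_map_iff hN.aemeasurable (p := fun M => M A ≠ ∞)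
      (measurableSet_eq_fun (hm A hA) measurable_const).compl).2 (hfin A hA hAf)
  · have hfm : Measurable fun M : Measure E =>
        Complex.exp ((∑ i, t i * (M (A i)).toReal : ℝ) * Complex.I) := by
      have : Measurable fun M : Measure E => ∑ i, t i * (M (A i)).toReal :=
        Finset.measurable_fun_sum _ fun i _ => (hm _ (hA i)).ennreal_toReal.const_mul _
      fun_prop
    rw [integral_map hN.aemeasurable hfm.aestronglyMeasurable]
    have h1 := h (phaseFn A t) (measurable_phaseFn hA t) (fun x => (norm_phaseFn hdisj t x).le)
      (integrable_one_sub_phaseFn hA hAf t)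
    rw [integral_one_sub_phaseFn hA hAf, neg_neg] at h1
    refine tendsto_nhds_unique ?_ h1
    refine tendsto_integral_of_dominated_convergence (fun _ => 1) (fun n => ?_)
      (integrable_const _) (fun n => ae_of_all _ fun ω => ?_) ?_
    · exact (Finset.measurable_prod _ fun k _ =>
        (measurable_phaseFn hA t).comp (he k)).aestronglyMeasurable
    · rw [norm_prod]
      exact Finset.prod_le_one (fun _ _ => norm_nonneg _) fun _ _ => (norm_phaseFn hdisj t _).le
    · filter_upwards [ae_all_iff.2 fun i => hfin (A i) (hA i) (hAf i)] with ω hω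
      simp_rw [prod_phaseFn hdisj]
      refine ((by fun_prop : Continuous fun r : ℝ => Complex.exp ((r : ℂ) *
        Complex.I)).tendsto _).comp (tendsto_finsetSum _ fun i _ => ?_)
      refine Tendsto.const_mul _ ?_
      refine ((ENNReal.tendsto_toReal (hω i)).comp (hNA (A i) (hA i) ω)).congr fun n => ?_
      rw [Function.comp_apply, ENNReal.toReal_sum fun k _ => by
        by_cases hk : e k ω ∈ A i <;> simp [hk]]
      refine Finset.sum_congr rfl fun k _ => ?_
      by_cases hk : e k ω ∈ A i <;> simp [hk]

end Points
end TruncRM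
namespace TruncRM
open Filter Topology

-- Compound Poisson point processes

theorem measurable_sum_range {Ω δ : Type*} [MeasurableSpace Ω] [MeasurableSpace δ] [AddCommMonoid δ]
    [MeasurableAdd₂ δ] {C : Ω → ℕ} (hC : Measurable C) {f : ℕ → Ω → δ}
    (hf : ∀ k, Measurable (f k)) : Measurable fun ω => ∑ k ∈ Finset.range (C ω), f k ω := by
  have : Measurable fun z : ℕ × Ω => ∑ k ∈ Finset.range z.1, f k z.2 :=
    measurable_from_prod_countable_right fun n => Finset.measurable_fun_sum (Finset.range n) fun k _ => hf k
  exact this.comp (hC.prodMk measurable_id)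

theorem measurable_sum_range_dirac {Ω E : Type*} [MeasurableSpace Ω] [MeasurableSpace E]
    {C : Ω → ℕ} (hC : Measurable C) {Y : ℕ → Ω → E} (hY : ∀ k, Measurable (Y k)) :
    Measurable fun ω => ∑ k ∈ Finset.range (C ω), Measure.dirac (Y k ω) := by
  refine Measure.measurable_of_measurable_coe _ fun A hA => ?_
  simp only [Measure.finsetSum_apply, Measure.dirac_apply' _ hA]
  exact measurable_sum_range hC fun k => (measurable_const.indicator hA).comp (hY k)

/-- A Poisson number of independent points with law `κ` is a Poisson process of rate `r • κ`. -/
theorem hasPoissonCharFun_compound {Ω E : Type*} [MeasurableSpace Ω] [MeasurableSpace E]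
    {P : Measure Ω} [IsProbabilityMeasure P] {C : Ω → ℕ} (hC : Measurable C) {Y : ℕ → Ω → E}
    (hY : ∀ k, Measurable (Y k)) {r : ℝ≥0} (hCl : P.map C = poissonMeasure r) {κ : Measure E}
    [IsProbabilityMeasure κ] (hYl : ∀ k, P.map (Y k) = κ) (hYi : iIndepFun Y P)
    (hCY : IndepFun C (fun ω k => Y k ω) P) :
    HasPoissonCharFun (P.map fun ω => ∑ k ∈ Finset.range (C ω), Measure.dirac (Y k ω))
      (r • κ) := by
  have hN := measurable_sum_range_dirac hC hY
  have hm : ∀ A : Set E, MeasurableSet A → Measurable fun M : Measure E => M A :=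
    fun A hA => Measure.measurable_coe hA
  refine ⟨fun A hA _ => ?_, fun n A hA hAf hdisj t => ?_⟩
  · refine (ae_map_iff hN.aemeasurable (p := fun M => M A ≠ ∞)
      (measurableSet_eq_fun (hm A hA) measurable_const).compl).2 (ae_of_all _ fun ω => ?_)
    exact measure_ne_top _ _
  · have hκf : ∀ i, κ (A i) ≠ ∞ := fun i => measure_ne_top _ _
    have hfm : Measurable fun M : Measure E =>
        Complex.exp ((∑ i, t i * (M (A i)).toReal : ℝ) * Complex.I) := by
      have : Measurable fun M : Measure E => ∑ i, t i * (M (A i)).toReal :=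
        Finset.measurable_fun_sum _ fun i _ => (hm _ (hA i)).ennreal_toReal.const_mul _
      fun_prop
    rw [integral_map hN.aemeasurable hfm.aestronglyMeasurable]
    have h1 : ∀ ω, Complex.exp ((∑ i, t i *
        ((∑ k ∈ Finset.range (C ω), Measure.dirac (Y k ω)) (A i)).toReal : ℝ) * Complex.I) =
        ∏ k ∈ Finset.range (C ω), phaseFn A t (Y k ω) := fun ω => by
      rw [prod_phaseFn hdisj]
      congr 3
      refine Finset.sum_congr rfl fun i _ => ?_
      rw [Measure.finsetSum_apply, ENNReal.toReal_sum fun k _ => measure_ne_top _ _]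
      congr 1
      refine Finset.sum_congr rfl fun k _ => ?_
      rw [Measure.dirac_apply' _ (hA i)]
      by_cases hk : Y k ω ∈ A i <;> simp [hk]
    simp_rw [h1]
    have hφm := measurable_phaseFn hA t
    let q : ℕ × (ℕ → E) → ℂ := fun z => ∏ k ∈ Finset.range z.1, phaseFn A t (z.2 k)
    have hq : Measurable q := measurable_from_prod_countable_right fun m =>
      Finset.measurable_fun_prod (Finset.range m) fun k _ => hφm.comp (measurable_pi_apply k)
    have hYm : Measurable fun ω k => Y k ω := measurable_pi_lambda _ hY
    have h2 := IndepFun.integral_comp_eq hC hYm hCY hq (C := 1) fun z => by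
      rw [norm_prod]
      exact Finset.prod_le_one (fun _ _ => norm_nonneg _) fun _ _ => (norm_phaseFn hdisj t _).le
    -- For `m` points the expectation is `z ^ m` with `z = ∫ phaseFn dκ`. Averaging over the Poisson
    -- number of points gives the generating function `exp(r (z - 1))`.
    have h3 : ∀ m : ℕ, ∫ y, q (m, y) ∂(P.map fun ω k => Y k ω) =
        (∫ e, phaseFn A t e ∂κ) ^ m := fun m => by
      rw [integral_map hYm.aemeasurable (f := fun y => q (m, y))
        (hq.comp measurable_prodMk_left).aestronglyMeasurable]
      have h4 : iIndepFun (fun (i : Fin m) ω => phaseFn A t (Y i ω)) P :=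
        (hYi.precomp Fin.val_injective).comp (fun _ => phaseFn A t) fun _ => hφm
      have h5 := h4.integral_fun_prod_eq_prod_integral
        fun i => (hφm.comp (hY i)).aestronglyMeasurable
      have h6 : ∀ k, ∫ ω, phaseFn A t (Y k ω) ∂P = ∫ e, phaseFn A t e ∂κ := fun k => by
        rw [← hYl k, integral_map (hY k).aemeasurable hφm.aestronglyMeasurable]
      simp only [h6, Finset.prod_const, Finset.card_univ, Fintype.card_fin] at h5
      rw [← h5]
      simp only [q, Finset.prod_range]
    refine h2.trans ?_
    simp_rw [h3]
    have h7 : ∫ e, phaseFn A t e ∂κ =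
        1 + ∑ i, (κ (A i)).toReal * (Complex.exp (t i * Complex.I) - 1) := by
      have h8 := integral_one_sub_phaseFn (μ := κ) hA hκf t
      have h9 : Integrable (phaseFn A t) κ := (integrable_const (1 : ℝ)).mono'
        hφm.aestronglyMeasurable (ae_of_all _ fun e => (norm_phaseFn hdisj t e).le)
      rw [integral_sub (integrable_const _) h9] at h8
      simp only [integral_const, probReal_univ, one_smul] at h8
      linear_combination -h8
    set z := ∫ e, phaseFn A t e ∂κ
    rw [← integral_map hC.aemeasurable (f := fun m : ℕ => z ^ m) (by fun_prop), hCl,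
      integral_poissonMeasure]
    have h10 : ∀ m : ℕ, (Real.exp (-r) * (r : ℝ) ^ m / m.factorial) • z ^ m =
        Real.exp (-r) * ((r * z) ^ m / m.factorial) := fun m => by
      rw [Complex.real_smul]
      push_cast
      rw [mul_pow]
      ring
    simp_rw [h10]
    rw [tsum_mul_left, (NormedSpace.expSeries_div_hasSum_exp ((r : ℂ) * z)).tsum_eq,
      ← Complex.exp_eq_exp_ℂ, Complex.ofReal_exp, ← Complex.exp_add, h7]
    congr 1
    simp only [Measure.smul_apply, mul_add, Finset.mul_sum]
    push_cast
    simp only [mul_one, neg_add_cancel_left]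
    refine Finset.sum_congr rfl fun i _ => ?_
    have : (r • κ (A i)).toReal = r * (κ (A i)).toReal := by
      rw [ENNReal.smul_def, smul_eq_mul, ENNReal.toReal_mul, ENNReal.coe_toReal]
    rw [this]
    push_cast
    ring

/-! ### The measure made of the points of a point process -/

section MarkedSum

variable {Ψ : Type*} [MeasurableSpace Ψ]

theorem markedSum_apply (M : Measure (ℝ × Ψ)) {B : Set Ψ} (hB : MeasurableSet B) :
    markedSum M B = ∫⁻ z, B.indicator (fun _ => ENNReal.ofReal z.1) z.2 ∂M := by
  rw [markedSum, Measure.map_apply measurable_snd hB,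
    withDensity_apply _ (measurable_snd hB), ← lintegral_indicator (measurable_snd hB)]
  rfl

theorem measurable_markedSum_integrand {B : Set Ψ} (hB : MeasurableSet B) :
    Measurable fun z : ℝ × Ψ => B.indicator (fun _ => ENNReal.ofReal z.1) z.2 := by
  have : (fun z : ℝ × Ψ => B.indicator (fun _ => ENNReal.ofReal z.1) z.2) =
      (Prod.snd ⁻¹' B).indicator fun z => ENNReal.ofReal z.1 := rfl
  rw [this]
  exact Measurable.indicator (by fun_prop) (measurable_snd hB)

theorem measurable_markedSum : Measurable (markedSum : Measure (ℝ × Ψ) → Measure Ψ) := by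
  refine Measure.measurable_of_measurable_coe _ fun B hB => ?_
  simp_rw [markedSum_apply _ hB]
  exact Measure.measurable_lintegral (measurable_markedSum_integrand hB)

theorem markedSum_add (M₁ M₂ : Measure (ℝ × Ψ)) :
    markedSum (M₁ + M₂) = markedSum M₁ + markedSum M₂ := by
  ext B hB
  simp only [Measure.add_apply, markedSum_apply _ hB, lintegral_add_measure]

theorem markedSum_sum_dirac (w : ℕ → ℝ) (ψ : ℕ → Ψ) :
    markedSum (Measure.sum fun k => Measure.dirac (w k, ψ k)) = atomicMeasure w ψ := by
  ext B hB
  rw [markedSum_apply _ hB, lintegral_sum_measure, atomicMeasure, Measure.sum_apply _ hB]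
  refine tsum_congr fun k => ?_
  rw [lintegral_dirac' _ (measurable_markedSum_integrand hB)]
  by_cases hk : ψ k ∈ B <;> simp [hk, Measure.dirac_apply' _ hB]

theorem markedSum_sum_range_dirac (K : ℕ) (w : ℕ → ℝ) (ψ : ℕ → Ψ) :
    markedSum (∑ k ∈ Finset.range K, Measure.dirac (w k, ψ k)) = atomicMeasureTrunc K w ψ := by
  ext B hB
  rw [markedSum_apply _ hB, lintegral_finsetSum_measure, atomicMeasureTrunc,
    Measure.finsetSum_apply]
  refine Finset.sum_congr rfl fun k _ => ?_
  rw [lintegral_dirac' _ (measurable_markedSum_integrand hB)]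
  by_cases hk : ψ k ∈ B <;> simp [hk, Measure.dirac_apply' _ hB]

end MarkedSum

/-! ### The rate measure of the beta process -/

instance sigmaFinite_betaRate (γ α d : ℝ) : SigmaFinite (betaRate γ α d) := by
  unfold betaRate
  exact SigmaFinite.withDensity_ofReal _

/-- The Gamma quotient reduces to `α` by `Γ(α + 1) = α Γ(α)`. Dropping the null endpoint `1` keeps
`1 - θ` strictly positive in later computations. -/
theorem betaRate_zero {γ α : ℝ} (hα : 0 < α) : betaRate γ α 0 =
    volume.withDensity ((Ioo (0 : ℝ) 1).indicator fun θ =>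
      ENNReal.ofReal (γ * α * θ⁻¹ * (1 - θ) ^ (α - 1))) := by
  rw [betaRate, withDensity_indicator measurableSet_Ioo, Measure.restrict_congr_set Ioo_ae_eq_Ioc]
  refine withDensity_congr_ae (ae_of_all _ fun θ => ?_)
  have h1 : Real.Gamma (α + 1) / (Real.Gamma (1 - 0) * Real.Gamma (α + 0)) = α := by
    rw [Real.Gamma_add_one hα.ne', sub_zero, Real.Gamma_one, add_zero, one_mul,
      mul_div_assoc, div_self (Real.Gamma_pos_of_pos hα).ne', mul_one]
  beta_reduce
  rw [h1, sub_zero, add_zero, Real.rpow_neg_one]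

theorem betaMeasure_one {α : ℝ} (hα : 0 < α) : betaMeasure 1 α =
    volume.withDensity ((Ioo (0 : ℝ) 1).indicator fun θ =>
      ENNReal.ofReal (α * (1 - θ) ^ (α - 1))) := by
  rw [betaMeasure]
  congr 1
  funext θ
  have h1 : 1 / beta 1 α = α := by
    rw [beta, Real.Gamma_one, one_mul, add_comm 1 α, Real.Gamma_add_one hα.ne']
    field_simp [(Real.Gamma_pos_of_pos hα).ne']
  by_cases hθ : θ ∈ Ioo (0 : ℝ) 1
  · rw [betaPDF_of_pos_lt_one hθ.1 hθ.2, indicator_of_mem hθ, h1]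
    simp
  · rw [indicator_of_notMem hθ, betaPDF_eq, if_neg (by simpa using hθ), ENNReal.ofReal_zero]

/-- The rates of `BP(γα/(α+1), α+1, 0)` and of the additional beta distributed atoms add up to the
rate of `BP(γ, α, 0)`. -/
theorem betaRate_add {γ α : ℝ} (hγ : 0 < γ) (hα : 0 < α) :
    betaRate (γ * α / (α + 1)) (α + 1) 0 + γ.toNNReal • betaMeasure 1 α = betaRate γ α 0 := by
  have h1 : γ.toNNReal • betaMeasure 1 α = volume.withDensity ((Ioo (0 : ℝ) 1).indicator fun θ =>
      ENNReal.ofReal (γ * (α * (1 - θ) ^ (α - 1)))) := by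
    have : γ.toNNReal • betaMeasure 1 α = ENNReal.ofReal γ • betaMeasure 1 α := rfl
    rw [this, betaMeasure_one hα, ← withDensity_smul _
      (Measurable.indicator (by fun_prop) measurableSet_Ioo)]
    congr 1
    funext θ
    by_cases hθ : θ ∈ Ioo (0 : ℝ) 1
    · simp [hθ, ENNReal.ofReal_mul hγ.le]
    · simp [hθ]
  rw [betaRate_zero (by linarith), betaRate_zero hα, h1, ← withDensity_add_left
    (Measurable.indicator (by fun_prop) measurableSet_Ioo)]
  congr 1
  funext θ
  by_cases hθ : θ ∈ Ioo (0 : ℝ) 1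
  · have hθ1 : 0 < 1 - θ := sub_pos.2 hθ.2
    have hθ0 : 0 < θ := hθ.1
    -- With `γα(1-θ)^{α-1}` factored out, the two densities contribute `θ⁻¹(1-θ)` and `1`, whose sum
    -- is `θ⁻¹`.
    have hp : (1 - θ) ^ (α + 1 - 1) = (1 - θ) ^ (α - 1) * (1 - θ) := by
      rw [← Real.rpow_add_one hθ1.ne']
      congr 1
      ring
    simp only [Pi.add_apply, indicator_of_mem hθ]
    rw [← ENNReal.ofReal_add (by positivity) (by positivity), hp]
    congr 1
    field_simp
    ring
  · simp [hθ]

/-! ### Superposition -/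

/-- `Θ` is given only through its law, so no Poisson process generating it need exist on `Ω`. The
superposition is therefore formed on the product of the two process laws and transported by
`markedSum`, which is additive. -/
theorem isBetaProcess_add_compound {Ω Ψ : Type*} [MeasurableSpace Ω] [MeasurableSpace Ψ]
    {P : Measure Ω} [IsProbabilityMeasure P] {G : Measure Ψ} [IsProbabilityMeasure G] {γ α : ℝ}
    (hγ : 0 < γ) (hα : 0 < α) {Θ : Ω → Measure Ψ} {C : Ω → ℕ} {θ' : ℕ → Ω → ℝ} {ψ' : ℕ → Ω → Ψ}
    (hΘ : IsBetaProcess P G (γ * α / (α + 1)) (α + 1) 0 Θ)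
    (hC : IsCompoundInput P G γ (betaMeasure 1 α) C θ' ψ')
    (hind : IndepFun Θ (fun ω => (C ω, fun k : ℕ => (θ' k ω, ψ' k ω))) P) :
    IsBetaProcess P G γ α 0
      (fun ω => Θ ω + atomicMeasureTrunc (C ω) (fun k => θ' k ω) (fun k => ψ' k ω)) := by
  obtain ⟨Q₁, hQ₁, hΘm, hΘl⟩ := hΘ
  have := isProbabilityMeasureBeta one_pos hα
  have := hQ₁.isProbabilityMeasure
  have hY : ∀ k, Measurable fun ω => (θ' k ω, ψ' k ω) := fun k =>
    (hC.measurable_θ k).prodMk (hC.measurable_ψ k)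
  have hN := measurable_sum_range_dirac hC.measurable_C hY
  set N : Ω → Measure (ℝ × Ψ) := fun ω =>
    ∑ k ∈ Finset.range (C ω), Measure.dirac (θ' k ω, ψ' k ω) with hNdef
  have := Measure.isProbabilityMeasure_map (μ := P) hN.aemeasurable
  have hQ₂ : IsPoissonProcessLaw (P.map N) ((γ.toNNReal • betaMeasure 1 α).prod G) := by
    have h1 : γ.toNNReal • (betaMeasure 1 α).prod G = (γ.toNNReal • betaMeasure 1 α).prod G :=
      (Measure.prod_smul_left (γ.toNNReal : ℝ≥0∞)).symm
    have h2 := hasPoissonCharFun_compound hC.measurable_C hY hC.law_C hC.law hC.indep hC.indep_C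
    rw [h1] at h2
    exact h2.isPoissonProcessLaw
  have hrate : (betaRate (γ * α / (α + 1)) (α + 1) 0).prod G +
      (γ.toNNReal • betaMeasure 1 α).prod G = (betaRate γ α 0).prod G := by
    rw [← Measure.add_prod, betaRate_add hγ hα]
  have : SigmaFinite ((betaRate (γ * α / (α + 1)) (α + 1) 0).prod G +
      (γ.toNNReal • betaMeasure 1 α).prod G) := by
    rw [hrate]
    infer_instance
  have hQ := hQ₁.add hQ₂
  rw [hrate] at hQ
  have hT : ∀ ω, atomicMeasureTrunc (C ω) (fun k => θ' k ω) (fun k => ψ' k ω) =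
      markedSum (N ω) := fun ω => (markedSum_sum_range_dirac _ _ _).symm
  simp_rw [hT]
  have hTm : Measurable fun ω => markedSum (N ω) := measurable_markedSum.comp hN
  have haddm : ∀ {β : Type _} [MeasurableSpace β],
      Measurable fun M : Measure β × Measure β => M.1 + M.2 := fun {β} _ => by
    refine Measure.measurable_of_measurable_coe _ fun A hA => ?_
    simp only [Measure.add_apply]
    exact ((Measure.measurable_coe hA).comp measurable_fst).add
      ((Measure.measurable_coe hA).comp measurable_snd)
  have hindT : IndepFun Θ (fun ω => markedSum (N ω)) P := by
    have hF : Measurable fun z : ℕ × (ℕ → ℝ × Ψ) =>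
        markedSum (∑ k ∈ Finset.range z.1, Measure.dirac (z.2 k)) :=
      measurable_markedSum.comp (measurable_sum_range_dirac measurable_fst
        fun k => (measurable_pi_apply k).comp measurable_snd)
    exact hind.comp measurable_id hF
  refine ⟨_, hQ, haddm.comp_aemeasurable (hΘm.prodMk hTm.aemeasurable), ?_⟩
  have h1 := (indepFun_iff_map_prod_eq_prod_map_map hΘm hTm.aemeasurable).1 hindT
  have h2 : P.map (fun ω => markedSum (N ω)) = (P.map N).map markedSum :=
    (Measure.map_map measurable_markedSum hN).symm
  have h3 : P.map (fun ω => Θ ω + markedSum (N ω)) =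
      (P.map fun ω => (Θ ω, markedSum (N ω))).map fun M => M.1 + M.2 :=
    (AEMeasurable.map_map_of_aemeasurable haddm.aemeasurable
      (hΘm.prodMk hTm.aemeasurable)).symm
  rw [h3, h1, h2, hΘl, Measure.map_prod_map _ _ measurable_markedSum measurable_markedSum,
    Measure.map_map haddm (measurable_markedSum.prodMap measurable_markedSum),
    Measure.map_map measurable_markedSum haddm]
  congr 1
  funext M
  exact (markedSum_add _ _).symm

end TruncRM
namespace TruncRM
open Filter Topology

/-! ### The law `Beta(1, b)` -/

theorem isProbabilityMeasure_betaOne {b : ℝ} (hb : 0 ≤ b) : IsProbabilityMeasure (betaOne b) := by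
  unfold betaOne
  split_ifs with h
  · infer_instance
  · exact isProbabilityMeasureBeta one_pos (lt_of_le_of_ne hb (Ne.symm h))

theorem betaOne_ae {b : ℝ} (hb : 0 ≤ b) : ∀ᵐ v ∂(betaOne b), 0 < v ∧ v ≤ 1 := by
  have hm : MeasurableSet {v : ℝ | 0 < v ∧ v ≤ 1} := measurableSet_Ioc
  unfold betaOne
  split_ifs with h
  · rw [ae_dirac_iff hm]
    norm_num
  · rw [betaMeasure_one (lt_of_le_of_ne hb (Ne.symm h)), withDensity_indicator measurableSet_Ioo]
    refine (withDensity_absolutelyContinuous _ _).ae_le ?_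
    filter_upwards [ae_restrict_mem measurableSet_Ioo] with v hv
    exact ⟨hv.1, hv.2.le⟩

theorem betaOne_Ioi {b : ℝ} (hb : 0 ≤ b) {θ : ℝ} (hθ : θ ∈ Ioo (0 : ℝ) 1) :
    betaOne b (Ioi θ) = ENNReal.ofReal ((1 - θ) ^ b) := by
  unfold betaOne
  split_ifs with h
  · simp [h, hθ.2]
  · have hb' : 0 < b := lt_of_le_of_ne hb (Ne.symm h)
    rw [betaMeasure_one hb', withDensity_indicator measurableSet_Ioo,
      withDensity_apply _ measurableSet_Ioi, Measure.restrict_restrict measurableSet_Ioi]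
    have h1 : Ioi θ ∩ Ioo 0 1 = Ioo θ 1 := by
      ext x
      simp only [mem_inter_iff, mem_Ioi, mem_Ioo]
      exact ⟨fun hx => ⟨hx.1, hx.2.2⟩, fun hx => ⟨hx.1, hθ.1.trans hx.1, hx.2⟩⟩
    have h2 : IntervalIntegrable (fun x : ℝ => b * (1 - x) ^ (b - 1)) volume θ 1 := by
      have := (intervalIntegral.intervalIntegrable_rpow' (a := 1 - θ) (b := 0)
        (r := b - 1) (by linarith)).comp_sub_left 1
      simp only [sub_sub_cancel, sub_zero] at this
      exact this.const_mul b
    have h3 : ∫ x in θ..1, b * (1 - x) ^ (b - 1) = (1 - θ) ^ b := by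
      rw [intervalIntegral.integral_const_mul,
        intervalIntegral.integral_comp_sub_left (fun x : ℝ => x ^ (b - 1)),
        integral_rpow (Or.inl (by linarith))]
      simp only [sub_self, sub_add_cancel, Real.zero_rpow h, sub_zero]
      field_simp
    rw [h1, Measure.restrict_congr_set Ioo_ae_eq_Ioc, ← ofReal_integral_eq_lintegral_ofReal,
      ← intervalIntegral.integral_of_le hθ.2.le, h3]
    · exact (intervalIntegrable_iff_integrableOn_Ioc_of_le hθ.2.le).1 h2
    · filter_upwards [ae_restrict_mem measurableSet_Ioc] with x hx
      have : 0 ≤ 1 - x := sub_nonneg.2 hx.2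
      exact mul_nonneg hb (Real.rpow_nonneg this _)

/-! ### The rate measure of the Bondesson representation -/

/-- The change of variables `θ = v e^{-t/c}`, for which `dt` becomes `(c/θ) dθ` in absolute value.
-/
theorem lintegral_mul_exp_neg_div {c : ℝ} (hc : 0 < c) {v : ℝ} (hv : 0 < v) (F : ℝ → ℝ≥0∞) :
    ∫⁻ t in Ioi (0 : ℝ), F (v * Real.exp (-t / c)) =
      ∫⁻ θ in Ioo 0 v, ENNReal.ofReal (c / θ) * F θ := by
  set f : ℝ → ℝ := fun t => v * Real.exp (-t / c) with hf
  have hfpos : ∀ t, 0 < f t := fun t => mul_pos hv (Real.exp_pos _)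
  have himg : f '' Ioi 0 = Ioo 0 v := by
    ext θ
    constructor
    · rintro ⟨t, ht, rfl⟩
      refine ⟨hfpos t, mul_lt_of_lt_one_right hv (Real.exp_lt_one_iff.2 ?_)⟩
      exact div_neg_of_neg_of_pos (neg_lt_zero.2 ht) hc
    · rintro ⟨h0, h1⟩
      refine ⟨-c * Real.log (θ / v), ?_, ?_⟩
      · have := Real.log_neg (div_pos h0 hv) ((div_lt_one hv).2 h1)
        rw [mem_Ioi]
        nlinarith
      · simp only [hf]
        rw [show -(-c * Real.log (θ / v)) / c = Real.log (θ / v) by field_simp,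
          Real.exp_log (div_pos h0 hv)]
        field_simp
  have hder : ∀ t ∈ Ioi (0 : ℝ), HasDerivWithinAt f (v * (Real.exp (-t / c) * (-1 / c))) (Ioi 0) t :=
    fun t _ => (((hasDerivAt_neg t).div_const c).exp.const_mul v).hasDerivWithinAt
  have hinj : InjOn f (Ioi 0) := by
    intro a _ b _ hab
    have h1 := Real.exp_injective (mul_left_cancel₀ hv.ne' hab)
    field_simp at h1
    linarith
  rw [← himg, lintegral_image_eq_lintegral_abs_deriv_mul measurableSet_Ioi hder hinj]
  refine setLIntegral_congr_fun measurableSet_Ioi fun t _ => ?_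
  have h1 : |v * (Real.exp (-t / c) * (-1 / c))| = f t / c := by
    rw [show v * (Real.exp (-t / c) * (-1 / c)) = -(f t / c) by simp only [hf]; ring, abs_neg,
      abs_of_pos (div_pos (hfpos t) hc)]
  have h2 : f t / c * (c / f t) = 1 := by
    have := (hfpos t).ne'
    field_simp
  change F (f t) = _
  rw [h1, ← mul_assoc, ← ENNReal.ofReal_mul (div_pos (hfpos t) hc).le, h2, ENNReal.ofReal_one,
    one_mul]

/-- After the change of variables for fixed `v`, Tonelli integrates the constraint `θ < v` over `v`.
This gives the density `(γα/θ) · P(V > θ)`, and the tail of `Beta(1, α-1)` is `(1-θ)^{α-1}`,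
including the point mass case `α = 1`. -/
theorem map_bondesson_rate {γ α : ℝ} (hγ : 0 < γ) (hα : 1 ≤ α) :
    ((volume.restrict (Ioi (0 : ℝ))).prod (betaOne (α - 1))).map
      (fun z => z.2 * Real.exp (-z.1 / (γ * α))) = betaRate γ α 0 := by
  have hb : 0 ≤ α - 1 := sub_nonneg.2 hα
  have hα0 : 0 < α := by linarith
  have hc : 0 < γ * α := mul_pos hγ hα0
  have := isProbabilityMeasure_betaOne hb
  refine Measure.ext_of_lintegral _ fun F hF => ?_
  have hTm : Measurable fun z : ℝ × ℝ => z.2 * Real.exp (-z.1 / (γ * α)) := by fun_prop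
  rw [lintegral_map hF hTm, lintegral_prod_symm' (fun z : ℝ × ℝ => F (z.2 * Real.exp (-z.1 / (γ * α)))) (hF.comp hTm)]
  have h1 : ∫⁻ v, (∫⁻ t in Ioi (0 : ℝ), F (v * Real.exp (-t / (γ * α)))) ∂(betaOne (α - 1)) =
      ∫⁻ v, (∫⁻ θ in Ioi (0 : ℝ), {z : ℝ × ℝ | z.2 < z.1}.indicator
        (fun z => ENNReal.ofReal (γ * α / z.2) * F z.2) (v, θ)) ∂(betaOne (α - 1)) := by
    refine lintegral_congr_ae ?_
    filter_upwards [betaOne_ae hb] with v hv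
    rw [lintegral_mul_exp_neg_div hc hv.1, show Ioo 0 v = Iio v ∩ Ioi 0 from by ext; simp [and_comm],
      ← Measure.restrict_restrict measurableSet_Iio, ← lintegral_indicator measurableSet_Iio]
    rfl
  have hGm : Measurable ({z : ℝ × ℝ | z.2 < z.1}.indicator
        (fun z => ENNReal.ofReal (γ * α / z.2) * F z.2)) :=
    Measurable.indicator (by fun_prop) (measurableSet_lt measurable_snd measurable_fst)
  rw [h1, lintegral_lintegral_swap (f := fun v θ => {z : ℝ × ℝ | z.2 < z.1}.indicator
    (fun z => ENNReal.ofReal (γ * α / z.2) * F z.2) (v, θ)) hGm.aemeasurable]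
  have h2 : ∀ θ : ℝ, ∫⁻ v, {z : ℝ × ℝ | z.2 < z.1}.indicator
      (fun z => ENNReal.ofReal (γ * α / z.2) * F z.2) (v, θ) ∂(betaOne (α - 1)) =
      ENNReal.ofReal (γ * α / θ) * F θ * betaOne (α - 1) (Ioi θ) := fun θ => by
    rw [← lintegral_indicator_const measurableSet_Ioi]
    rfl
  simp_rw [h2]
  rw [betaRate_zero hα0, withDensity_indicator measurableSet_Ioo,
    lintegral_withDensity_eq_lintegral_mul _ (by fun_prop) hF,
    ← lintegral_indicator measurableSet_Ioi, ← lintegral_indicator measurableSet_Ioo]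
  refine lintegral_congr fun θ => ?_
  by_cases h0 : 0 < θ
  · rw [indicator_of_mem (show θ ∈ Ioi (0 : ℝ) from h0)]
    by_cases h1 : θ < 1
    · rw [indicator_of_mem (show θ ∈ Ioo (0 : ℝ) 1 from ⟨h0, h1⟩), betaOne_Ioi hb ⟨h0, h1⟩,
        mul_right_comm, ← ENNReal.ofReal_mul (by positivity), div_eq_mul_inv]
      rfl
    · have h3 : betaOne (α - 1) (Ioi θ) = 0 := by
        refine measure_mono_null (t := {v | ¬(0 < v ∧ v ≤ 1)}) (fun v hv hv' => ?_)
          (betaOne_ae hb)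
        exact h1 (lt_of_lt_of_le hv hv'.2)
      rw [h3, mul_zero, indicator_of_notMem fun h => h1 h.2]
  · rw [indicator_of_notMem (show θ ∉ Ioi (0 : ℝ) from h0), indicator_of_notMem fun h => h0 h.1]

/-- The point of `ℝ × Ψ` produced by an arrival time `t` with marks `(v, ψ)`. -/
noncomputable def bondessonPoint {Ψ : Type*} (c : ℝ) (z : ℝ × (ℝ × Ψ)) : ℝ × Ψ :=
  (z.2.1 * Real.exp (-z.1 / c), z.2.2)

section Bondesson

variable {Ω Ψ : Type*} [MeasurableSpace Ω] [MeasurableSpace Ψ]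

theorem measurable_bondessonPoint (c : ℝ) :
    Measurable (bondessonPoint c : ℝ × (ℝ × Ψ) → ℝ × Ψ) := by
  unfold bondessonPoint
  fun_prop

theorem map_bondessonPoint {G : Measure Ψ} [IsProbabilityMeasure G] {γ α : ℝ} (hγ : 0 < γ)
    (hα : 1 ≤ α) :
    ((volume.restrict (Ioi (0 : ℝ))).prod ((betaOne (α - 1)).prod G)).map
      (bondessonPoint (γ * α)) = (betaRate γ α 0).prod G := by
  have := isProbabilityMeasure_betaOne (sub_nonneg.2 hα)
  have hTm : Measurable fun z : ℝ × ℝ => z.2 * Real.exp (-z.1 / (γ * α)) := by fun_prop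
  have h1 : MeasurePreserving (fun z : ℝ × ℝ => z.2 * Real.exp (-z.1 / (γ * α)))
      ((volume.restrict (Ioi (0 : ℝ))).prod (betaOne (α - 1))) (betaRate γ α 0) :=
    ⟨hTm, map_bondesson_rate hγ hα⟩
  have h2 := h1.prod (MeasurePreserving.id G)
  have h3 := (measurePreserving_prodAssoc (volume.restrict (Ioi (0 : ℝ))) (betaOne (α - 1)) G).symm
  exact (h2.comp h3).map_eq

variable {P : Measure Ω} {G : Measure Ψ} {E V : ℕ → Ω → ℝ} {ψ : ℕ → Ω → Ψ}

theorem IsBondessonInput.isMarkedArrivals {g : Measure ℝ} (h : IsBondessonInput P G g E V ψ) :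
    IsMarkedArrivals P (g.prod G) E (fun k ω => (V k ω, ψ k ω)) :=
  ⟨h.measurable_E, fun k => (h.measurable_V k).prodMk (h.measurable_ψ k), h.indep, h.law⟩

theorem IsBondessonInput.measurable_weight {g : Measure ℝ} (h : IsBondessonInput P G g E V ψ)
    (c : ℝ) (k : ℕ) : Measurable (bondessonWeight c E V k) := by
  have h1 : Measurable fun ω => ∑ i ∈ Finset.range (k + 1), E i ω :=
    Finset.measurable_fun_sum _ fun i _ => h.measurable_E i
  have := h.measurable_V k
  unfold bondessonWeight
  fun_prop

/-- The exponential formula for the points of the Bondesson representation after the `K`-th one. -/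
theorem IsBondessonInput.tendsto_integral_prod [IsProbabilityMeasure P] [IsProbabilityMeasure G]
    {γ α : ℝ} (hγ : 0 < γ) (hα : 1 ≤ α) (h : IsBondessonInput P G (betaOne (α - 1)) E V ψ)
    {φ : ℝ × Ψ → ℂ} (hφ : Measurable φ) (hφ1 : ∀ z, ‖φ z‖ ≤ 1)
    (hint : Integrable (fun z => 1 - φ z) ((betaRate γ α 0).prod G)) (K : ℕ) :
    Tendsto (fun n => ∫ ω, ∏ k ∈ Finset.Ico K (K + n),
      φ (bondessonWeight (γ * α) E V k ω, ψ k ω) ∂P) atTop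
      (𝓝 (∫ ω, Complex.exp (-∫ z, (1 - φ (z.1 * Real.exp (-arrival E K ω / (γ * α)), z.2))
        ∂((betaRate γ α 0).prod G)) ∂P)) := by
  have := isProbabilityMeasure_betaOne (sub_nonneg.2 hα)
  have hTm := measurable_bondessonPoint (Ψ := Ψ) (γ * α)
  rw [← map_bondessonPoint hγ hα] at hint ⊢
  have hfm : Measurable fun z => 1 - φ z := measurable_const.sub hφ
  have hint' := (integrable_map_measure hfm.aestronglyMeasurable hTm.aemeasurable).1 hint
  have h1 := h.isMarkedArrivals.tendsto_integral_prod (hφ.comp hTm) (fun z => hφ1 _) hint' K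
  refine (h1.congr fun n => rfl).trans (le_of_eq ?_)
  congr 1
  refine integral_congr_ae ?_
  filter_upwards [h.isMarkedArrivals.ae_pos] with ω hω
  have hs : 0 ≤ arrival E K ω := Finset.sum_nonneg fun i _ => (hω i).le
  set s := arrival E K ω
  congr 2
  have hle : (volume.restrict (Ioi s)).prod ((betaOne (α - 1)).prod G) ≤
      (volume.restrict (Ioi (0 : ℝ))).prod ((betaOne (α - 1)).prod G) :=
    Measure.prod_mono (Measure.restrict_mono (Ioi_subset_Ioi hs) le_rfl) le_rfl
  rw [← integral_prod (fun z => 1 - (φ ∘ bondessonPoint (γ * α)) z) (hint'.mono_measure hle)]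
  -- Restarting the clock at `s` multiplies every weight by `e^{-s/c}`, so the tail after `s` is the
  -- full rate with rescaled weights.
  have hmp : MeasurePreserving (fun t : ℝ => s + t) (volume.restrict (Ioi 0))
      (volume.restrict (Ioi s)) := by
    have := (measurePreserving_add_left (volume : Measure ℝ) s).restrict_preimage
      (measurableSet_Ioi (a := s))
    simpa using this
  have hmp2 := hmp.prod (MeasurePreserving.id ((betaOne (α - 1)).prod G))
  have hgm : Measurable fun z : ℝ × Ψ => 1 - φ (z.1 * Real.exp (-s / (γ * α)), z.2) :=
    measurable_const.sub (hφ.comp (by fun_prop))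
  rw [← hmp2.map_eq, integral_map (f := fun z => 1 - (φ ∘ bondessonPoint (γ * α)) z)
      hmp2.aemeasurable (hfm.comp hTm).aestronglyMeasurable,
    integral_map hTm.aemeasurable hgm.aestronglyMeasurable]
  refine integral_congr_ae (ae_of_all _ fun z => ?_)
  simp only [Function.comp_apply, bondessonPoint, Prod.map, id]
  rw [mul_assoc, ← Real.exp_add, neg_add_rev, add_div]

theorem isBetaProcess_of_isBondessonRep [IsProbabilityMeasure P] [IsProbabilityMeasure G]
    {γ α : ℝ} (hγ : 0 < γ) (hα : 1 ≤ α) {Θ : Ω → Measure Ψ}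
    (h : IsBondessonRep P G (γ * α) (betaOne (α - 1)) Θ) : IsBetaProcess P G γ α 0 Θ := by
  obtain ⟨E, V, ψ, hin, rfl⟩ := h
  have hY : ∀ k, Measurable fun ω => (bondessonWeight (γ * α) E V k ω, ψ k ω) := fun k =>
    (hin.measurable_weight _ k).prodMk (hin.measurable_ψ k)
  have hN := measurable_sum_dirac hY
  have := Measure.isProbabilityMeasure_map (μ := P) hN.aemeasurable
  have hQ : HasPoissonCharFun _ ((betaRate γ α 0).prod G) :=
    hasPoissonCharFun_of_tendsto (P := P) hY fun φ hφ hφ1 hint => by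
      simpa [arrival] using hin.tendsto_integral_prod hγ hα hφ hφ1 hint 0
  have hΘ : (fun ω => atomicMeasure (fun k => bondessonWeight (γ * α) E V k ω)
      (fun k => ψ k ω)) = fun ω => markedSum (Measure.sum fun k =>
        Measure.dirac (bondessonWeight (γ * α) E V k ω, ψ k ω)) :=
    funext fun ω => (markedSum_sum_dirac _ _).symm
  refine ⟨_, hQ.isPoissonProcessLaw, ?_, ?_⟩
  · rw [hΘ]
    exact (measurable_markedSum.comp hN).aemeasurable
  · rw [hΘ, Measure.map_map measurable_markedSum hN]
    rfl

end Bondesson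
end TruncRM
namespace TruncRM
open Filter Topology

/-! ### Total variation distance of the marginal laws -/

section MarginalDensity

variable {Ω Ψ 𝒴 : Type*} [MeasurableSpace Ω] [MeasurableSpace Ψ] [MeasurableSpace 𝒴]
  {P : Measure Ω} {f : Kernel (Measure Ψ) 𝒴} {N : ℕ} {m : Measure (Fin N → 𝒴)}

theorem measurable_pi_kernel [IsMarkovKernel f] {X : Fin N → Ω → Measure Ψ}
    (hX : ∀ n, Measurable (X n)) :
    Measurable fun ω => Measure.pi fun n => f (X n ω) := by
  refine Measurable.measure_of_isPiSystem_of_isProbabilityMeasure generateFrom_pi.symm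
    isPiSystem_pi ?_
  rintro _ ⟨A, hA, rfl⟩
  simp_rw [Measure.pi_pi]
  exact Finset.measurable_fun_prod _ fun n _ => (f.measurable_coe (hA n trivial)).comp (hX n)

/-- The density is specified on boxes only. Boxes form a generating π-system, so the identity
extends to all measurable sets, in particular to `{q < p}`, where total variation is attained. -/
theorem IsMarginalDensity.withDensity_eq [IsProbabilityMeasure P] [IsMarkovKernel f]
    {X : Fin N → Ω → Measure Ψ} (hX : ∀ n, Measurable (X n)) {p : (Fin N → 𝒴) → ℝ}
    (hp : IsMarginalDensity P f X m p) :
    m.withDensity (fun y => ENNReal.ofReal (p y)) =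
      (P.map fun ω => Measure.pi fun n => f (X n ω)).join := by
  have hκ := measurable_pi_kernel (f := f) hX
  have hbox : ∀ A : Fin N → Set 𝒴, (∀ n, MeasurableSet (A n)) →
      m.withDensity (fun y => ENNReal.ofReal (p y)) (pi univ A) =
        (P.map fun ω => Measure.pi fun n => f (X n ω)).join (pi univ A) := by
    intro A hA
    have hAm : MeasurableSet (pi univ A) := MeasurableSet.univ_pi hA
    rw [withDensity_apply _ hAm, hp.2.2 A hA, Measure.join_apply hAm,
      lintegral_map (Measure.measurable_coe hAm) hκ]
    simp_rw [Measure.pi_pi]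
  have huniv := hbox (fun _ => univ) fun _ => MeasurableSet.univ
  rw [pi_univ] at huniv
  have : IsFiniteMeasure (m.withDensity fun y => ENNReal.ofReal (p y)) := by
    refine ⟨?_⟩
    rw [huniv, Measure.join_apply MeasurableSet.univ,
      lintegral_map (Measure.measurable_coe MeasurableSet.univ) hκ]
    simp
  refine ext_of_generate_finite _ generateFrom_pi.symm isPiSystem_pi ?_ huniv
  rintro _ ⟨A, hA, rfl⟩
  exact hbox A (by simpa using hA)

theorem IsMarginalDensity.lintegral_eq_one [IsProbabilityMeasure P] [IsMarkovKernel f]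
    {X : Fin N → Ω → Measure Ψ} {p : (Fin N → 𝒴) → ℝ} (hp : IsMarginalDensity P f X m p) :
    ∫⁻ y, ENNReal.ofReal (p y) ∂m = 1 := by
  have := hp.2.2 (fun _ => univ) fun _ => MeasurableSet.univ
  simpa using this

theorem IsMarginalDensity.integrable [IsProbabilityMeasure P] [IsMarkovKernel f]
    {X : Fin N → Ω → Measure Ψ} {p : (Fin N → 𝒴) → ℝ} (hp : IsMarginalDensity P f X m p) :
    Integrable p m := by
  rw [← lintegral_ofReal_ne_top_iff_integrable hp.1.aestronglyMeasurable (ae_of_all _ hp.2.1),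
    hp.lintegral_eq_one]
  exact ENNReal.one_ne_top

theorem IsMarginalDensity.integral_eq_one [IsProbabilityMeasure P] [IsMarkovKernel f]
    {X : Fin N → Ω → Measure Ψ} {p : (Fin N → 𝒴) → ℝ} (hp : IsMarginalDensity P f X m p) :
    ∫ y, p y ∂m = 1 := by
  rw [integral_eq_lintegral_of_nonneg_ae (ae_of_all _ hp.2.1) hp.1.aestronglyMeasurable,
    hp.lintegral_eq_one, ENNReal.toReal_one]

/-- The total variation distance of two marginal laws is at most the probability that the
underlying measures differ. -/
theorem IsMarginalDensity.half_integral_abs_sub_le [IsProbabilityMeasure P] [IsMarkovKernel f]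
    {X Z : Fin N → Ω → Measure Ψ} (hX : ∀ n, Measurable (X n)) (hZ : ∀ n, Measurable (Z n))
    {p q : (Fin N → 𝒴) → ℝ} (hp : IsMarginalDensity P f X m p) (hq : IsMarginalDensity P f Z m q)
    {D : Set Ω} (hD : MeasurableSet D) (hXZ : ∀ ω ∉ D, ∀ n, X n ω = Z n ω) :
    (1 / 2) * ∫ y, |p y - q y| ∂m ≤ P.real D := by
  -- Since both densities integrate to one, half the `L¹` distance equals `∫_B (p - q)`. The two
  -- mixtures over `ω` have the same integrand off `D`, and on `D` it is at most one.
  set B : Set (Fin N → 𝒴) := {y | q y < p y} with hB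
  have hBm : MeasurableSet B := measurableSet_lt hq.1 hp.1
  have hpm := hp.withDensity_eq hX
  have hqm := hq.withDensity_eq hZ
  have hκX := measurable_pi_kernel (f := f) hX
  have hκZ := measurable_pi_kernel (f := f) hZ
  have hle : ∫⁻ y in B, ENNReal.ofReal (p y) ∂m ≤ P D + ∫⁻ y in B, ENNReal.ofReal (q y) ∂m := by
    rw [← withDensity_apply _ hBm, ← withDensity_apply _ hBm, hpm, hqm, Measure.join_apply hBm,
      Measure.join_apply hBm, lintegral_map (Measure.measurable_coe hBm) hκX,
      lintegral_map (Measure.measurable_coe hBm) hκZ, ← lintegral_indicator_one hD,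
      ← lintegral_add_left (measurable_one.indicator hD)]
    refine lintegral_mono fun ω => ?_
    by_cases hω : ω ∈ D
    · simp only [indicator_of_mem hω, Pi.one_apply]
      exact prob_le_one.trans le_self_add
    · simp only [indicator_of_notMem hω, zero_add, hXZ ω hω]
      exact le_rfl
  have hpi := hp.integrable
  have hqi := hq.integrable
  have hleR : ∫ y in B, p y ∂m ≤ P.real D + ∫ y in B, q y ∂m := by
    rw [integral_eq_lintegral_of_nonneg_ae (ae_of_all _ hp.2.1) hp.1.aestronglyMeasurable,
      integral_eq_lintegral_of_nonneg_ae (ae_of_all _ hq.2.1) hq.1.aestronglyMeasurable,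
      measureReal_def]
    have hqf : ∫⁻ y in B, ENNReal.ofReal (q y) ∂m ≠ ∞ :=
      ((setLIntegral_le_lintegral _ _).trans_lt (hq.lintegral_eq_one ▸ ENNReal.one_lt_top)).ne
    rw [← ENNReal.toReal_add (measure_ne_top P D) hqf]
    exact ENNReal.toReal_mono (ENNReal.add_ne_top.2 ⟨measure_ne_top P D, hqf⟩) hle
  have habs : ∀ y, |p y - q y| = 2 * B.indicator (fun y => p y - q y) y - (p y - q y) := by
    intro y
    by_cases hy : y ∈ B
    · rw [indicator_of_mem hy, abs_of_pos (sub_pos.2 hy)]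
      ring
    · rw [indicator_of_notMem hy, abs_of_nonpos (sub_nonpos.2 (not_lt.1 hy))]
      ring
  have hdi : Integrable (fun y => p y - q y) m := hpi.sub hqi
  simp_rw [habs]
  rw [integral_sub ((hdi.indicator hBm).const_mul 2) hdi, integral_const_mul,
    integral_indicator hBm, integral_sub hpi hqi, hp.integral_eq_one, hq.integral_eq_one,
    integral_sub hpi.integrableOn hqi.integrableOn]
  linarith

end MarginalDensity

/-! ### Arrays of counts with the same conditional law -/

section Arrays

variable {Ω Ψ : Type*} [MeasurableSpace Ω] [MeasurableSpace Ψ] {P : Measure Ω}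

/-- The conditional law fixes the mass of each `A ×ˢ {a}`. For finite `S` there are countably many
`a`, so these masses determine the joint law. -/
theorem IsLikelihoodArray.map_restrict_eq [IsProbabilityMeasure P] {h : ℝ → ℕ → ℝ}
    {θ : ℕ → Ω → ℝ} {ψ : ℕ → Ω → Ψ} (hθ : ∀ k, Measurable (θ k)) (hψ : ∀ k, Measurable (ψ k))
    {N : ℕ} {x z : Fin N → ℕ → Ω → ℕ} (hx : IsLikelihoodArray P h θ ψ x)
    (hz : IsLikelihoodArray P h θ ψ z) (S : Finset (Fin N × ℕ)) :
    P.map (fun ω => ((fun k => (θ k ω, ψ k ω)), fun s : S => x s.1.1 s.1.2 ω)) =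
      P.map (fun ω => ((fun k => (θ k ω, ψ k ω)), fun s : S => z s.1.1 s.1.2 ω)) := by
  classical
  have hp : Measurable fun ω k => (θ k ω, ψ k ω) :=
    measurable_pi_lambda _ fun k => (hθ k).prodMk (hψ k)
  have hT : ∀ {w : Fin N → ℕ → Ω → ℕ}, IsLikelihoodArray P h θ ψ w →
      Measurable fun ω => ((fun k => (θ k ω, ψ k ω)), fun s : S => w s.1.1 s.1.2 ω) := fun hw =>
    hp.prodMk (measurable_pi_lambda _ fun s => hw.measurable _ _)
  have hval : ∀ {w : Fin N → ℕ → Ω → ℕ}, IsLikelihoodArray P h θ ψ w →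
      ∀ A : Set (ℕ → ℝ × Ψ), MeasurableSet A → ∀ a : S → ℕ,
      P.map (fun ω => ((fun k => (θ k ω, ψ k ω)), fun s : S => w s.1.1 s.1.2 ω)) (A ×ˢ {a}) =
        ∫⁻ ω in {ω | (fun k => (θ k ω, ψ k ω)) ∈ A},
          ∏ s ∈ S, ENNReal.ofReal (h (θ s.2 ω) (if hs : s ∈ S then a ⟨s, hs⟩ else 0)) ∂P := by
    intro w hw A hA a
    rw [Measure.map_apply (hT hw) (hA.prod (measurableSet_singleton a)),
      ← hw.cond_law A hA S fun s => if hs : s ∈ S then a ⟨s, hs⟩ else 0]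
    congr 1
    ext ω
    simp only [mem_preimage, mem_prod, mem_singleton_iff, mem_ofPred_eq, and_congr_right_iff]
    intro _
    constructor
    · intro hω s hs
      rw [dif_pos hs, ← hω]
    · intro hω
      funext s
      rw [hω s.1 s.2, dif_pos s.2]
  have := Measure.isProbabilityMeasure_map (μ := P) (hT hx).aemeasurable
  refine Measure.ext_prod fun {A B} hA hB => ?_
  have hBU : A ×ˢ B = ⋃ a ∈ B, A ×ˢ ({a} : Set (S → ℕ)) := by
    ext q
    simp
  have hdisj : B.PairwiseDisjoint fun a => A ×ˢ ({a} : Set (S → ℕ)) := fun a _ b _ hab =>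
    disjoint_left.2 fun q hq hq' => hab (hq.2.symm.trans hq'.2)
  rw [hBU, measure_biUnion B.to_countable hdisj fun a _ => hA.prod (measurableSet_singleton a),
    measure_biUnion B.to_countable hdisj fun a _ => hA.prod (measurableSet_singleton a)]
  simp_rw [hval hx A hA, hval hz A hA]

theorem measurable_atomicMeasure_nat {x : ℕ → Ω → ℕ} {ψ : ℕ → Ω → Ψ} (hx : ∀ k, Measurable (x k))
    (hψ : ∀ k, Measurable (ψ k)) :
    Measurable fun ω => atomicMeasure (fun k => (x k ω : ℝ)) (fun k => ψ k ω) := by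
  have h1 : ∀ k, Measurable fun ω => ((x k ω : ℝ), ψ k ω) := fun k =>
    ((measurable_from_top (f := fun n : ℕ => (n : ℝ))).comp (hx k)).prodMk (hψ k)
  simp_rw [← markedSum_sum_dirac]
  exact measurable_markedSum.comp (measurable_sum_dirac h1)

theorem measurable_atomicMeasureTrunc_nat {x : ℕ → Ω → ℕ} {ψ : ℕ → Ω → Ψ}
    (hx : ∀ k, Measurable (x k)) (hψ : ∀ k, Measurable (ψ k)) (K : ℕ) :
    Measurable fun ω => atomicMeasureTrunc K (fun k => (x k ω : ℝ)) (fun k => ψ k ω) := by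
  have h1 : ∀ k, Measurable fun ω => ((x k ω : ℝ), ψ k ω) := fun k =>
    ((measurable_from_top (f := fun n : ℕ => (n : ℝ))).comp (hx k)).prodMk (hψ k)
  simp_rw [← markedSum_sum_range_dirac]
  exact measurable_markedSum.comp (measurable_sum_range_dirac measurable_const h1)

theorem measurable_atomicMeasureTrunc_snd (K : ℕ) (a : ℕ → ℕ) :
    Measurable fun y : ℕ → ℝ × Ψ =>
      atomicMeasureTrunc K (fun k => (a k : ℝ)) fun k => (y k).2 := by
  have hψ : ∀ k, Measurable fun y : ℕ → ℝ × Ψ => (y k).2 := fun k =>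
    measurable_snd.comp (measurable_pi_apply k)
  have hx : ∀ k, Measurable fun _ : ℕ → ℝ × Ψ => a k := fun k => measurable_const
  exact measurable_atomicMeasureTrunc_nat hx hψ K

/-- The marginal density of the truncated model does not depend on the array of counts. -/
theorem IsMarginalDensity.congr_array [IsProbabilityMeasure P] {h : ℝ → ℕ → ℝ}
    {θ : ℕ → Ω → ℝ} {ψ : ℕ → Ω → Ψ} (hθ : ∀ k, Measurable (θ k)) (hψ : ∀ k, Measurable (ψ k))
    {N K : ℕ} {x z : Fin N → ℕ → Ω → ℕ} (hx : IsLikelihoodArray P h θ ψ x)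
    (hz : IsLikelihoodArray P h θ ψ z) {𝒴 : Type*} [MeasurableSpace 𝒴]
    {f : Kernel (Measure Ψ) 𝒴} {m : Measure (Fin N → 𝒴)} {q : (Fin N → 𝒴) → ℝ}
    (hq : IsMarginalDensity P f
      (fun n ω => atomicMeasureTrunc K (fun k => (z n k ω : ℝ)) fun k => ψ k ω) m q) :
    IsMarginalDensity P f
      (fun n ω => atomicMeasureTrunc K (fun k => (x n k ω : ℝ)) fun k => ψ k ω) m q := by
  classical
  refine ⟨hq.1, hq.2.1, fun A hA => (hq.2.2 A hA).trans ?_⟩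
  obtain ⟨S, hS⟩ : ∃ S : Finset (Fin N × ℕ), ∀ n, ∀ k ∈ Finset.range K, (n, k) ∈ S :=
    ⟨Finset.univ ×ˢ Finset.range K, fun n k hk => Finset.mem_product.2 ⟨Finset.mem_univ _, hk⟩⟩
  -- The default `0` is never read: the truncated measure only uses indices `k < K`, all of which
  -- lie in `S`.
  let e : (S → ℕ) → Fin N → ℕ → ℕ := fun b n k => if hs : (n, k) ∈ S then b ⟨(n, k), hs⟩ else 0
  let F : (ℕ → ℝ × Ψ) × (S → ℕ) → ℝ≥0∞ := fun y =>
    ∏ n, f (atomicMeasureTrunc K (fun k => (e y.2 n k : ℝ)) fun k => (y.1 k).2) (A n)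
  have hF : Measurable F := measurable_from_prod_countable_left fun b =>
    Finset.measurable_fun_prod Finset.univ fun n _ => (f.measurable_coe (hA n)).comp
      (measurable_atomicMeasureTrunc_snd K (e b n))
  have hp : Measurable fun ω k => (θ k ω, ψ k ω) :=
    measurable_pi_lambda _ fun k => (hθ k).prodMk (hψ k)
  have hT : ∀ {w : Fin N → ℕ → Ω → ℕ}, IsLikelihoodArray P h θ ψ w →
      ∫⁻ ω, ∏ n, f (atomicMeasureTrunc K (fun k => (w n k ω : ℝ)) fun k => ψ k ω) (A n) ∂P =
      ∫⁻ y, F y ∂(P.map fun ω => ((fun k => (θ k ω, ψ k ω)), fun s : S => w s.1.1 s.1.2 ω)) := by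
    intro w hw
    rw [lintegral_map hF (hp.prodMk (measurable_pi_lambda _ fun s => hw.measurable _ _))]
    refine lintegral_congr fun ω => Finset.prod_congr rfl fun n _ => ?_
    congr 2
    refine Finset.sum_congr rfl fun k hk => ?_
    simp only [e, dif_pos (hS n k hk)]
  rw [hT hz, hT hx, hz.map_restrict_eq hθ hψ hx]

theorem atomicMeasure_eq_trunc {K : ℕ} {w : ℕ → ℝ} {ψ : ℕ → Ψ} (hw : ∀ k, K ≤ k → w k = 0) :
    atomicMeasure w ψ = atomicMeasureTrunc K w ψ := by
  ext B hB
  rw [atomicMeasure, Measure.sum_apply _ hB, atomicMeasureTrunc, Measure.finsetSum_apply]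
  refine tsum_eq_sum fun k hk => ?_
  rw [hw k (by simpa using hk)]
  simp

/-- No coupling of `x` and `z` is assumed. Replacing `z` by `x` leaves the truncated marginal law
unchanged, and after this the two models agree off the event that some count of index at least `K`
is nonzero. -/
theorem half_integral_abs_sub_le [IsProbabilityMeasure P] {h : ℝ → ℕ → ℝ} {θ : ℕ → Ω → ℝ}
    {ψ : ℕ → Ω → Ψ} (hθ : ∀ k, Measurable (θ k)) (hψ : ∀ k, Measurable (ψ k))
    {N K : ℕ} {x z : Fin N → ℕ → Ω → ℕ} (hx : IsLikelihoodArray P h θ ψ x)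
    (hz : IsLikelihoodArray P h θ ψ z) {𝒴 : Type*} [MeasurableSpace 𝒴]
    {f : Kernel (Measure Ψ) 𝒴} [IsMarkovKernel f] {m : Measure (Fin N → 𝒴)}
    {p q : (Fin N → 𝒴) → ℝ}
    (hp : IsMarginalDensity P f
      (fun n ω => atomicMeasure (fun k => (x n k ω : ℝ)) fun k => ψ k ω) m p)
    (hq : IsMarginalDensity P f
      (fun n ω => atomicMeasureTrunc K (fun k => (z n k ω : ℝ)) fun k => ψ k ω) m q) :
    (1 / 2) * ∫ y, |p y - q y| ∂m ≤ P.real {ω | ∃ n k, K ≤ k ∧ x n k ω ≠ 0} := by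
  have hD : MeasurableSet {ω | ∃ n k, K ≤ k ∧ x n k ω ≠ 0} := by
    simp only [ofPred_exists, ofPred_and]
    exact MeasurableSet.iUnion fun n => MeasurableSet.iUnion fun k =>
      (MeasurableSet.const _).inter ((hx.measurable n k) (measurableSet_singleton 0)).compl
  refine hp.half_integral_abs_sub_le
    (fun n => measurable_atomicMeasure_nat (hx.measurable n) hψ)
    (fun n => measurable_atomicMeasureTrunc_nat (hx.measurable n) hψ K)
    (hq.congr_array hθ hψ hx hz) hD fun ω hω n => atomicMeasure_eq_trunc fun k hk => ?_
  by_contra hne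
  exact hω ⟨n, k, hk, fun h0 => hne (by rw [h0, Nat.cast_zero])⟩

end Arrays
end TruncRM
namespace TruncRM
open Filter Topology

/-! ### Moments of the beta rate measure and gamma laws -/

theorem betaRate_ae {γ α : ℝ} (hα : 0 < α) : ∀ᵐ θ ∂(betaRate γ α 0), θ ∈ Ioo (0 : ℝ) 1 := by
  rw [betaRate_zero hα, withDensity_indicator measurableSet_Ioo]
  exact (withDensity_absolutelyContinuous _ _).ae_le (ae_restrict_mem measurableSet_Ioo)

/-- The factor `θ` cancels the singularity `θ⁻¹` and leaves `γ` times the `Beta(1, α)` density. -/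
theorem lintegral_id_betaRate {γ α : ℝ} (hγ : 0 < γ) (hα : 0 < α) :
    ∫⁻ θ, ENNReal.ofReal θ ∂(betaRate γ α 0) = ENNReal.ofReal γ := by
  have := isProbabilityMeasureBeta one_pos hα
  have hm : Measurable ((Ioo (0 : ℝ) 1).indicator fun θ =>
      ENNReal.ofReal (γ * α * θ⁻¹ * (1 - θ) ^ (α - 1))) :=
    Measurable.indicator (by fun_prop) measurableSet_Ioo
  have hm' : Measurable ((Ioo (0 : ℝ) 1).indicator fun θ =>
      ENNReal.ofReal (α * (1 - θ) ^ (α - 1))) :=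
    Measurable.indicator (by fun_prop) measurableSet_Ioo
  rw [betaRate_zero hα, lintegral_withDensity_eq_lintegral_mul _ hm (by fun_prop)]
  have h1 : ∫⁻ θ, (Ioo (0 : ℝ) 1).indicator (fun θ => ENNReal.ofReal (α * (1 - θ) ^ (α - 1))) θ = 1 := by
    have h2 := measure_univ (μ := betaMeasure 1 α)
    rwa [betaMeasure_one hα, withDensity_apply _ MeasurableSet.univ, Measure.restrict_univ] at h2
  rw [← mul_one (ENNReal.ofReal γ), ← h1, ← lintegral_const_mul _ hm']
  refine lintegral_congr fun θ => ?_
  by_cases hθ : θ ∈ Ioo (0 : ℝ) 1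
  · have h0 : 0 < θ := hθ.1
    have h3 : 0 < 1 - θ := sub_pos.2 hθ.2
    simp only [Pi.mul_apply, indicator_of_mem hθ]
    rw [← ENNReal.ofReal_mul (by positivity), ← ENNReal.ofReal_mul hγ.le]
    congr 1
    field_simp
  · simp [hθ]

theorem integrable_id_betaRate {γ α : ℝ} (hγ : 0 < γ) (hα : 0 < α) :
    Integrable (fun θ : ℝ => θ) (betaRate γ α 0) := by
  rw [← lintegral_ofReal_ne_top_iff_integrable (by fun_prop)
    ((betaRate_ae hα).mono fun θ hθ => hθ.1.le), lintegral_id_betaRate hγ hα]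
  exact ENNReal.ofReal_ne_top

theorem integral_id_betaRate {γ α : ℝ} (hγ : 0 < γ) (hα : 0 < α) :
    ∫ θ, θ ∂(betaRate γ α 0) = γ := by
  rw [integral_eq_lintegral_of_nonneg_ae ((betaRate_ae hα).mono fun θ hθ => hθ.1.le) (by fun_prop),
    lintegral_id_betaRate hγ hα, ENNReal.toReal_ofReal hγ.le]

instance isProbabilityMeasure_gammaLaw (K : ℕ) : IsProbabilityMeasure (gammaLaw K) := by
  unfold gammaLaw
  split_ifs with h
  · infer_instance
  · exact isProbabilityMeasure_gammaMeasure (by positivity) one_pos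

theorem gammaLaw_ae (K : ℕ) : ∀ᵐ t ∂(gammaLaw K), 0 ≤ t := by
  unfold gammaLaw
  split_ifs with h
  · rw [ae_dirac_iff (measurableSet_Ici (a := (0 : ℝ)))]
  · rw [gammaMeasure, ae_withDensity_iff (by unfold gammaPDF; fun_prop)]
    refine ae_of_all _ fun t ht => ?_
    by_contra hneg
    exact ht (gammaPDF_of_neg (not_le.1 hneg))

/-- Exponential tilting: `e^{-t/c}` times the `Gamma(K, 1)` density is `(c/(1+c))^K` times the
`Gamma(K, 1 + 1/c)` density. -/
theorem integral_exp_gammaLaw {c : ℝ} (hc : 0 < c) (K : ℕ) :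
    ∫ t, Real.exp (-t / c) ∂(gammaLaw K) = (c / (1 + c)) ^ K := by
  unfold gammaLaw
  split_ifs with h
  · simp [h]
  · have hK : (0 : ℝ) < K := by positivity
    have hr : (0 : ℝ) < 1 + 1 / c := by positivity
    rw [integral_eq_lintegral_of_nonneg_ae (ae_of_all _ fun t => (Real.exp_pos _).le) (by fun_prop),
      gammaMeasure, lintegral_withDensity_eq_lintegral_mul _ (by unfold gammaPDF; fun_prop)
        (by fun_prop)]
    have h1 : ∀ t : ℝ, (gammaPDF K 1 * fun t => ENNReal.ofReal (Real.exp (-t / c))) t =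
        ENNReal.ofReal ((c / (1 + c)) ^ K) * gammaPDF K (1 + 1 / c) t := fun t => by
      by_cases ht : 0 ≤ t
      · have hΓ := Real.Gamma_pos_of_pos hK
        rw [Pi.mul_apply, gammaPDF_of_nonneg ht, gammaPDF_of_nonneg ht,
          ← ENNReal.ofReal_mul (by positivity), ← ENNReal.ofReal_mul (by positivity)]
        congr 1
        have h2 : Real.exp (-((1 + 1 / c) * t)) = Real.exp (-(1 * t)) * Real.exp (-t / c) := by
          rw [← Real.exp_add]
          congr 1
          ring
        have h3 : (c / (1 + c)) ^ K * (1 + 1 / c) ^ (K : ℝ) = 1 := by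
          rw [Real.rpow_natCast, ← mul_pow]
          have : c / (1 + c) * (1 + 1 / c) = 1 := by
            field_simp
            ring
          rw [this, one_pow]
        rw [h2, Real.one_rpow]
        linear_combination (-(1 / Real.Gamma K * t ^ ((K : ℝ) - 1) *
          (Real.exp (-(1 * t)) * Real.exp (-t / c)))) * h3
      · rw [Pi.mul_apply, gammaPDF_of_neg (not_le.1 ht), gammaPDF_of_neg (not_le.1 ht), zero_mul,
          mul_zero]
    simp_rw [h1]
    rw [lintegral_const_mul _ (by unfold gammaPDF; fun_prop), lintegral_gammaPDF_eq_one hK hr,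
      mul_one, ENNReal.toReal_ofReal (by positivity)]

/-- The exponentials multiply to the constant `e^{-r}`, leaving `∫_0^r x^{a-1} dx = r^a / a`; then
`a Γ(a) = Γ(a + 1)`. -/
theorem lintegral_gammaPDF_convolution {a : ℝ} (ha : 0 < a) (r : ℝ) :
    ∫⁻ x, gammaPDF a 1 x * gammaPDF 1 1 (r - x) = gammaPDF (a + 1) 1 r := by
  by_cases hr : 0 ≤ r
  · have h1 : ∀ x, gammaPDF a 1 x * gammaPDF 1 1 (r - x) = (Icc 0 r).indicator
        (fun x => ENNReal.ofReal (1 / Real.Gamma a * Real.exp (-r) * x ^ (a - 1))) x := fun x => by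
      by_cases hx : x ∈ Icc 0 r
      · rw [indicator_of_mem hx, gammaPDF_of_nonneg hx.1, gammaPDF_of_nonneg (sub_nonneg.2 hx.2),
          ← ENNReal.ofReal_mul]
        · congr 1
          simp only [Real.one_rpow, Real.Gamma_one, sub_self, Real.rpow_zero, one_mul, div_one]
          have : Real.exp (-r) = Real.exp (-x) * Real.exp (-(r - x)) := by
            rw [← Real.exp_add]
            congr 1
            ring
          rw [this]
          ring
        · have := Real.Gamma_pos_of_pos ha
          have := Real.rpow_nonneg hx.1 (a - 1)
          positivity
      · rw [indicator_of_notMem hx]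
        by_cases hx0 : 0 ≤ x
        · rw [gammaPDF_of_neg (x := r - x) (sub_neg.2 (not_le.1 fun h => hx ⟨hx0, h⟩)), mul_zero]
        · rw [gammaPDF_of_neg (not_le.1 hx0), zero_mul]
    simp_rw [h1]
    have hi : IntervalIntegrable (fun x : ℝ => 1 / Real.Gamma a * Real.exp (-r) * x ^ (a - 1))
        volume 0 r := (intervalIntegral.intervalIntegrable_rpow' (by linarith)).const_mul _
    rw [lintegral_indicator measurableSet_Icc, Measure.restrict_congr_set Ioc_ae_eq_Icc.symm,
      ← ofReal_integral_eq_lintegral_ofReal, ← intervalIntegral.integral_of_le hr,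
      intervalIntegral.integral_const_mul, integral_rpow (Or.inl (by linarith)),
      gammaPDF_of_nonneg hr]
    · congr 1
      rw [Real.Gamma_add_one ha.ne', sub_add_cancel, Real.zero_rpow ha.ne', add_sub_cancel_right,
        Real.one_rpow, one_mul]
      have := (Real.Gamma_pos_of_pos ha).ne'
      field_simp
      ring
    · exact (intervalIntegrable_iff_integrableOn_Ioc_of_le hr).1 hi
    · filter_upwards [ae_restrict_mem measurableSet_Ioc] with x hx
      have := Real.Gamma_pos_of_pos ha
      have := Real.rpow_nonneg hx.1.le (a - 1)
      positivity
  · rw [gammaPDF_of_neg (not_le.1 hr)]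
    refine (lintegral_congr fun x => ?_).trans lintegral_zero
    by_cases hx0 : 0 ≤ x
    · rw [gammaPDF_of_neg (x := r - x) (by linarith), mul_zero]
    · rw [gammaPDF_of_neg (not_le.1 hx0), zero_mul]

theorem gammaMeasure_conv_expMeasure {a : ℝ} (ha : 0 < a) :
    gammaMeasure a 1 ∗ expMeasure 1 = gammaMeasure (a + 1) 1 := by
  have := isProbabilityMeasure_gammaMeasure ha one_pos
  have hm : ∀ b : ℝ, Measurable (gammaPDF b 1) := fun b => by unfold gammaPDF; fun_prop
  refine Measure.ext_of_lintegral _ fun F hF => ?_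
  rw [Measure.lintegral_conv hF, expMeasure]
  simp only [gammaMeasure]
  rw [lintegral_withDensity_eq_lintegral_mul _ (hm _) hF]
  have h1 : ∀ x, ∫⁻ y, F (x + y) ∂(volume.withDensity (gammaPDF 1 1)) =
      ∫⁻ r, gammaPDF 1 1 (r - x) * F r := fun x => by
    rw [lintegral_withDensity_eq_lintegral_mul _ (hm _) (by fun_prop),
      ← lintegral_add_left_eq_self (fun r => gammaPDF 1 1 (r - x) * F r) x]
    simp
  simp_rw [h1]
  have hm2 : Measurable fun z : ℝ × ℝ => gammaPDF 1 1 (z.2 - z.1) * F z.2 :=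
    ((hm 1).comp (by fun_prop)).mul (hF.comp measurable_snd)
  rw [lintegral_withDensity_eq_lintegral_mul _ (hm a) hm2.lintegral_prod_right']
  have h2 : ∀ x, (gammaPDF a 1 * fun x => ∫⁻ r, gammaPDF 1 1 (r - x) * F r) x =
      ∫⁻ r, gammaPDF a 1 x * (gammaPDF 1 1 (r - x) * F r) := fun x => by
    exact (lintegral_const_mul _ (hm2.comp measurable_prodMk_left)).symm
  simp_rw [h2]
  rw [lintegral_lintegral_swap (f := fun x r => gammaPDF a 1 x * (gammaPDF 1 1 (r - x) * F r))
    (((hm a).comp measurable_fst).mul hm2).aemeasurable]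
  refine lintegral_congr fun r => ?_
  have h3 : Measurable fun x => gammaPDF a 1 x * gammaPDF 1 1 (r - x) :=
    (hm a).mul ((hm 1).comp (by fun_prop))
  rw [Pi.mul_apply, ← lintegral_gammaPDF_convolution ha, ← lintegral_mul_const _ h3]
  simp_rw [mul_assoc]

theorem gammaLaw_conv_expMeasure (K : ℕ) : gammaLaw K ∗ expMeasure 1 = gammaLaw (K + 1) := by
  unfold gammaLaw
  rcases Nat.eq_zero_or_pos K with rfl | hK
  · have := isProbabilityMeasure_gammaMeasure (a := 1) one_pos one_pos
    simp [expMeasure, Measure.dirac_zero_conv]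
  · rw [if_neg hK.ne', if_neg (Nat.succ_ne_zero K),
      gammaMeasure_conv_expMeasure (Nat.cast_pos.2 hK)]
    push_cast
    rfl

theorem IsMarkedArrivals.map_arrival {Ω 𝒲 : Type*} [MeasurableSpace Ω] [MeasurableSpace 𝒲]
    {P : Measure Ω} [IsProbabilityMeasure P] {H : Measure 𝒲} [IsProbabilityMeasure H]
    {E : ℕ → Ω → ℝ} {W : ℕ → Ω → 𝒲} (h : IsMarkedArrivals P H E W) (K : ℕ) :
    P.map (arrival E K) = gammaLaw K := by
  induction K with
  | zero =>
    have : arrival E 0 = fun _ => 0 := by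
      funext ω
      simp [arrival]
    rw [this, Measure.map_const]
    simp [gammaLaw]
  | succ K ih =>
    have hind : IndepFun (arrival E K) (E K) P := by
      have h1 : iIndepFun E P := h.indep.comp (fun _ => Prod.fst) fun _ => measurable_fst
      exact indepFun_prefix (F := fun y : ℕ → ℝ => ∑ i ∈ Finset.range K, y i) h.measurable_E h1 K
        (Finset.measurable_fun_sum _ fun i _ => measurable_pi_apply i)
        fun y y' hy => Finset.sum_congr rfl fun i hi => hy i (Finset.mem_range.1 hi)
    have h2 : arrival E (K + 1) = arrival E K + E K := by
      funext ω
      simp [arrival, Finset.sum_range_succ]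
    rw [h2, hind.map_add_eq_map_conv_map (h.measurable_arrival K) (h.measurable_E K), ih, h.map_E,
      gammaLaw_conv_expMeasure]

end TruncRM
namespace TruncRM
open Filter Topology

/-! ### The truncation error bound -/

theorem bernoulliLikelihood_zero (θ : ℝ) : bernoulliLikelihood θ 0 = 1 - θ := by
  simp [bernoulliLikelihood]

section Bound

variable {γ α : ℝ}

/-- The rate `v e^{-t/c}` lies in `[0, 1]` and the probability that one of `N` Bernoulli variables
with this success probability is nonzero is at most `N v e^{-t/c}`. -/
theorem one_sub_one_sub_pow_bounds {c : ℝ} (hc : 0 < c) {v t : ℝ} (hv : v ∈ Ioo (0 : ℝ) 1)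
    (ht : 0 ≤ t) (N : ℕ) :
    0 ≤ 1 - (1 - v * Real.exp (-t / c)) ^ N ∧
      1 - (1 - v * Real.exp (-t / c)) ^ N ≤ N * (v * Real.exp (-t / c)) ∧
      0 ≤ v * Real.exp (-t / c) ∧ v * Real.exp (-t / c) ≤ v := by
  have h0 : 0 ≤ v * Real.exp (-t / c) := mul_nonneg hv.1.le (Real.exp_pos _).le
  have h1 : v * Real.exp (-t / c) ≤ v := mul_le_of_le_one_right hv.1.le
    (Real.exp_le_one_iff.2 (div_nonpos_of_nonpos_of_nonneg (neg_nonpos.2 ht) hc.le))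
  have h2 : v * Real.exp (-t / c) ≤ 1 := h1.trans hv.2.le
  refine ⟨sub_nonneg.2 (pow_le_one₀ (sub_nonneg.2 h2) (sub_le_self _ h0)), ?_, h0, h1⟩
  have := one_add_mul_le_pow (a := -(v * Real.exp (-t / c))) (by linarith) N
  rw [← sub_eq_add_neg] at this
  linarith [mul_neg (N : ℝ) (v * Real.exp (-t / c))]

theorem prod_betaRate_gammaLaw_ae (hα : 0 < α) (K : ℕ) :
    ∀ᵐ z ∂((betaRate γ α 0).prod (gammaLaw K)), z.1 ∈ Ioo (0 : ℝ) 1 ∧ 0 ≤ z.2 := by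
  have h1 : ∀ᵐ z ∂((betaRate γ α 0).prod (gammaLaw K)), z.1 ∈ Ioo (0 : ℝ) 1 :=
    Measure.quasiMeasurePreserving_fst.ae (betaRate_ae hα)
  have h2 : ∀ᵐ z ∂((betaRate γ α 0).prod (gammaLaw K)), 0 ≤ z.2 :=
    Measure.quasiMeasurePreserving_snd.ae (gammaLaw_ae K)
  exact h1.and h2

theorem integrable_one_sub_one_sub_pow (hγ : 0 < γ) (hα : 0 < α) {c : ℝ} (hc : 0 < c) (N K : ℕ) :
    Integrable (fun z : ℝ × ℝ => 1 - (1 - z.1 * Real.exp (-z.2 / c)) ^ N)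
      ((betaRate γ α 0).prod (gammaLaw K)) := by
  refine (((integrable_id_betaRate hγ hα).comp_fst (gammaLaw K)).const_mul (N : ℝ)).mono'
    (by fun_prop) ?_
  filter_upwards [prod_betaRate_gammaLaw_ae hα K] with z hz
  obtain ⟨h1, h2, _, h4⟩ := one_sub_one_sub_pow_bounds hc hz.1 hz.2 N
  rw [Real.norm_of_nonneg h1]
  exact h2.trans (mul_le_mul_of_nonneg_left h4 (Nat.cast_nonneg N))

theorem bondessonTruncBound_eq (hα : 0 < α) {c : ℝ} (hc : 0 < c) (N K : ℕ) :
    bondessonTruncBound bernoulliLikelihood (betaRate γ α 0) c N K =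
      1 - Real.exp (-∫ v, (∫ t, (1 - (1 - v * Real.exp (-t / c)) ^ N) ∂(gammaLaw K))
        ∂(betaRate γ α 0)) := by
  unfold bondessonTruncBound
  simp_rw [bernoulliLikelihood_zero]
  congr 3
  refine integral_congr_ae ?_
  filter_upwards [betaRate_ae hα] with v hv
  rw [integral_sub (integrable_const _)]
  · simp
  · refine (integrable_const (1 : ℝ)).mono' (by fun_prop) ?_
    filter_upwards [gammaLaw_ae K] with t ht
    obtain ⟨_, _, h3, h4⟩ := one_sub_one_sub_pow_bounds hc hv ht N
    have h5 : 0 ≤ 1 - v * Real.exp (-t / c) := by linarith [hv.2]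
    rw [Real.norm_of_nonneg (pow_nonneg h5 _)]
    exact pow_le_one₀ h5 (by linarith)

/-- After `1 - e^{-I} ≤ I` and Bernoulli's inequality the integrand is a product in `v` and `t`, so
the double integral splits into the first moment of the rate and an exponential moment of the gamma
law. -/
theorem bondessonTruncBound_le (hγ : 0 < γ) (hα : 0 < α) (N K : ℕ) :
    bondessonTruncBound bernoulliLikelihood (betaRate γ α 0) (γ * α) N K ≤
      N * γ * (γ * α / (1 + γ * α)) ^ K := by
  have hc : 0 < γ * α := mul_pos hγ hα
  rw [bondessonTruncBound_eq hα hc]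
  have hw := integrable_one_sub_one_sub_pow hγ hα hc N K
  rw [← integral_prod (fun z : ℝ × ℝ => 1 - (1 - z.1 * Real.exp (-z.2 / (γ * α))) ^ N) hw]
  set I := ∫ z : ℝ × ℝ, (1 - (1 - z.1 * Real.exp (-z.2 / (γ * α))) ^ N)
    ∂((betaRate γ α 0).prod (gammaLaw K)) with hI
  have hle : I ≤ N * γ * (γ * α / (1 + γ * α)) ^ K := by
    have hexp : Integrable (fun t : ℝ => Real.exp (-t / (γ * α))) (gammaLaw K) := by
      refine (integrable_const (1 : ℝ)).mono' (by fun_prop) ?_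
      filter_upwards [gammaLaw_ae K] with t ht
      rw [Real.norm_of_nonneg (Real.exp_pos _).le]
      exact Real.exp_le_one_iff.2 (div_nonpos_of_nonpos_of_nonneg (neg_nonpos.2 ht) hc.le)
    have hprod : ∫ z : ℝ × ℝ, N * (z.1 * Real.exp (-z.2 / (γ * α)))
        ∂((betaRate γ α 0).prod (gammaLaw K)) = N * γ * (γ * α / (1 + γ * α)) ^ K := by
      rw [integral_const_mul, integral_prod_mul (fun v : ℝ => v)
        (fun t : ℝ => Real.exp (-t / (γ * α))), integral_id_betaRate hγ hα,
        integral_exp_gammaLaw hc, mul_assoc]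
    rw [← hprod]
    refine integral_mono_ae hw (((integrable_id_betaRate hγ hα).mul_prod hexp).const_mul _) ?_
    filter_upwards [prod_betaRate_gammaLaw_ae hα K] with z hz
    exact (one_sub_one_sub_pow_bounds hc hz.1 hz.2 N).2.1
  have := Real.add_one_le_exp (-I)
  linarith

variable {Ω Ψ : Type*} [MeasurableSpace Ω] [MeasurableSpace Ψ] {P : Measure Ω}
  {G : Measure Ψ} [IsProbabilityMeasure G]
  {E V : ℕ → Ω → ℝ} {ψ : ℕ → Ω → Ψ}

theorem IsBondessonInput.tendsto_integral_prod_real [IsProbabilityMeasure P] (hγ : 0 < γ) (hα : 1 ≤ α)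
    (h : IsBondessonInput P G (betaOne (α - 1)) E V ψ) {φ : ℝ → ℝ} (hφ : Measurable φ)
    (hφ0 : ∀ θ, 0 ≤ φ θ) (hφ1 : ∀ θ, φ θ ≤ 1)
    (hint : Integrable (fun θ => 1 - φ θ) (betaRate γ α 0)) (K : ℕ) :
    Tendsto (fun n => ∫ ω, ∏ k ∈ Finset.Ico K (K + n), φ (bondessonWeight (γ * α) E V k ω) ∂P) atTop
      (𝓝 (∫ ω, Real.exp (-∫ θ, (1 - φ (θ * Real.exp (-arrival E K ω / (γ * α))))
        ∂(betaRate γ α 0)) ∂P)) := by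
  have h1 := h.tendsto_integral_prod hγ hα (φ := fun z => (φ z.1 : ℂ)) (by fun_prop)
    (fun z => by
      rw [Complex.norm_real, Real.norm_of_nonneg (hφ0 _)]
      exact hφ1 _)
    (by
      have := (hint.comp_fst G).ofReal (𝕜 := ℂ)
      simpa using this) K
  have h2 : ∀ ω, Complex.exp (-∫ z : ℝ × Ψ,
      (1 - (φ (z.1 * Real.exp (-arrival E K ω / (γ * α))) : ℂ)) ∂((betaRate γ α 0).prod G)) =
      ((Real.exp (-∫ θ, (1 - φ (θ * Real.exp (-arrival E K ω / (γ * α))))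
        ∂(betaRate γ α 0)) : ℝ) : ℂ) := fun ω => by
    rw [Complex.ofReal_exp, Complex.ofReal_neg, ← integral_complex_ofReal]
    congr 2
    have := integral_fun_fst (μ := betaRate γ α 0) (ν := G)
      (fun θ => (1 - (φ (θ * Real.exp (-arrival E K ω / (γ * α))) : ℂ)))
    rw [this]
    simp
  simp_rw [h2, ← Complex.ofReal_prod, integral_complex_ofReal] at h1
  have := (Complex.continuous_re.tendsto _).comp h1
  simpa only [Function.comp_def, Complex.ofReal_re] using this

theorem IsBondessonInput.weight_mem (hα : 1 ≤ α) (hγ : 0 < γ)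
    (h : IsBondessonInput P G (betaOne (α - 1)) E V ψ) :
    ∀ᵐ ω ∂P, ∀ k, bondessonWeight (γ * α) E V k ω ∈ Icc (0 : ℝ) 1 := by
  have hb : 0 ≤ α - 1 := sub_nonneg.2 hα
  have hc : 0 < γ * α := mul_pos hγ (by linarith)
  have := isProbabilityMeasure_betaOne hb
  have hV : ∀ᵐ ω ∂P, ∀ k, 0 < V k ω ∧ V k ω ≤ 1 := by
    rw [ae_all_iff]
    intro k
    have h1 := congrArg (Measure.map fun z : ℝ × ℝ × Ψ => z.2.1) (h.law k)
    rw [Measure.map_map (by fun_prop)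
      ((h.measurable_E k).prodMk ((h.measurable_V k).prodMk (h.measurable_ψ k))),
      ← Function.comp_def Prod.fst Prod.snd, ← Measure.map_map measurable_fst measurable_snd,
      Measure.map_snd_prod, measure_univ, one_smul, Measure.map_fst_prod, measure_univ,
      one_smul] at h1
    exact ae_of_ae_map (h.measurable_V k).aemeasurable
      ((congrArg ae h1).symm ▸ betaOne_ae hb)
  filter_upwards [hV, h.isMarkedArrivals.ae_pos] with ω h1 h2 k
  have hs : 0 ≤ ∑ i ∈ Finset.range (k + 1), E i ω := Finset.sum_nonneg fun i _ => (h2 i).le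
  have h3 : Real.exp (-(∑ i ∈ Finset.range (k + 1), E i ω) / (γ * α)) ≤ 1 :=
    Real.exp_le_one_iff.2 (div_nonpos_of_nonpos_of_nonneg (neg_nonpos.2 hs) hc.le)
  exact ⟨mul_nonneg (h1 k).1.le (Real.exp_pos _).le,
    mul_le_one₀ (h1 k).2 (Real.exp_pos _).le h3⟩

/-- The complement is the decreasing limit of the events that all counts with index in `[K, K + M)`
vanish, whose probabilities are expectations of `∏ (1 - θ_k)^N`. The exponential formula from
arrival `K` on evaluates the limit, and Jensen moves the expectation over `Γ_K` inside the
exponential. -/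
theorem measureReal_exists_ne_zero_le [IsProbabilityMeasure P] (hγ : 0 < γ) (hα : 1 ≤ α)
    (h : IsBondessonInput P G (betaOne (α - 1)) E V ψ) {N : ℕ} (K : ℕ) {x : Fin N → ℕ → Ω → ℕ}
    (hx : IsLikelihoodArray P bernoulliLikelihood (bondessonWeight (γ * α) E V) ψ x) :
    P.real {ω | ∃ n k, K ≤ k ∧ x n k ω ≠ 0} ≤
      bondessonTruncBound bernoulliLikelihood (betaRate γ α 0) (γ * α) N K := by
  have hα0 : 0 < α := by linarith
  have hc : 0 < γ * α := mul_pos hγ hα0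
  -- Clamping to `[0, 1]` makes `0 ≤ φ ≤ 1` hold everywhere, as the exponential formula requires;
  -- almost surely the weights lie in `[0, 1]`, where nothing changes.
  set φ : ℝ → ℝ := fun θ => (1 - max 0 (min θ 1)) ^ N with hφ
  have hφm : Measurable φ := by fun_prop
  have hmm : ∀ θ : ℝ, 0 ≤ max 0 (min θ 1) ∧ max 0 (min θ 1) ≤ 1 := fun θ =>
    ⟨le_max_left _ _, max_le zero_le_one (min_le_right _ _)⟩
  have hφ0 : ∀ θ, 0 ≤ φ θ := fun θ => pow_nonneg (sub_nonneg.2 (hmm θ).2) _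
  have hφ1 : ∀ θ, φ θ ≤ 1 := fun θ =>
    pow_le_one₀ (sub_nonneg.2 (hmm θ).2) (sub_le_self _ (hmm θ).1)
  have hφv : ∀ θ ∈ Icc (0 : ℝ) 1, φ θ = (1 - θ) ^ N := fun θ hθ => by
    simp only [hφ]
    rw [min_eq_left hθ.2, max_eq_right hθ.1]
  have hφi : Integrable (fun θ => 1 - φ θ) (betaRate γ α 0) := by
    refine ((integrable_id_betaRate hγ hα0).const_mul (N : ℝ)).mono' (by fun_prop) ?_
    filter_upwards [betaRate_ae hα0] with θ hθ
    have h1 := one_sub_one_sub_pow_bounds hc hθ le_rfl N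
    simp only [neg_zero, zero_div, Real.exp_zero, mul_one] at h1
    rw [hφv θ ⟨hθ.1.le, hθ.2.le⟩, Real.norm_of_nonneg h1.1]
    exact h1.2.1
  have hlim := h.tendsto_integral_prod_real hγ hα hφm hφ0 hφ1 hφi K
  set A : ℕ → Set Ω := fun M => {ω | ∀ s ∈ (Finset.univ : Finset (Fin N)) ×ˢ Finset.Ico K (K + M),
    x s.1 s.2 ω = 0} with hA
  have hAm : ∀ M, MeasurableSet (A M) := fun M => by
    simp only [hA, ofPred_forall]
    exact Finset.measurableSet_biInter _ fun s _ => hx.measurable _ _ (measurableSet_singleton 0)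
  have hanti : Antitone A := fun a b hab ω hω s hs => hω s (by
    rw [Finset.mem_product, Finset.mem_Ico] at hs ⊢
    exact ⟨hs.1, hs.2.1, by omega⟩)
  have hD : {ω | ∃ n k, K ≤ k ∧ x n k ω ≠ 0} = (⋂ M, A M)ᶜ := by
    ext ω
    simp only [mem_ofPred_eq, mem_compl_iff, mem_iInter, hA, Finset.mem_product, Finset.mem_univ,
      true_and, Finset.mem_Ico, not_forall]
    constructor
    · rintro ⟨n, k, hk, hne⟩
      -- The smallest `M` with `k < K + M`, given `K ≤ k`.
      exact ⟨k + 1 - K, (n, k), ⟨hk, by simp only; omega⟩, hne⟩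
    · rintro ⟨M, s, hs, hne⟩
      exact ⟨s.1, s.2, hs.1, hne⟩
  have hPA : ∀ M, P.real (A M) =
      ∫ ω, ∏ k ∈ Finset.Ico K (K + M), φ (bondessonWeight (γ * α) E V k ω) ∂P := fun M => by
    have h1 := hx.cond_law univ MeasurableSet.univ
      ((Finset.univ : Finset (Fin N)) ×ˢ Finset.Ico K (K + M)) fun _ => 0
    simp only [mem_univ, true_and, ofPred_true, Measure.restrict_univ,
      bernoulliLikelihood_zero] at h1
    have hw := h.measurable_weight (γ * α)
    rw [measureReal_def, hA, h1, integral_eq_lintegral_of_nonneg_ae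
      (ae_of_all _ fun ω => Finset.prod_nonneg fun k _ => hφ0 _)
      (Finset.measurable_fun_prod _ fun k _ => hφm.comp (hw k)).aestronglyMeasurable]
    congr 1
    refine lintegral_congr_ae ?_
    filter_upwards [h.weight_mem hα hγ] with ω hω
    rw [Finset.prod_product_right, ENNReal.ofReal_prod_of_nonneg fun k _ => hφ0 _]
    refine Finset.prod_congr rfl fun k _ => ?_
    change ∏ _n : Fin N, ENNReal.ofReal (1 - bondessonWeight (γ * α) E V k ω) = _
    rw [Finset.prod_const, Finset.card_univ, Fintype.card_fin, hφv _ (hω k),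
      ENNReal.ofReal_pow (sub_nonneg.2 (hω k).2)]
  have hlim2 : Tendsto (fun M => P.real (A M)) atTop (𝓝 (P.real (⋂ M, A M))) :=
    (ENNReal.tendsto_toReal (measure_ne_top _ _)).comp
      (tendsto_measure_iInter_atTop (fun M => (hAm M).nullMeasurableSet) hanti
        ⟨0, measure_ne_top _ _⟩)
  simp_rw [hPA] at hlim2
  have heq := tendsto_nhds_unique hlim2 hlim
  rw [hD, probReal_compl_eq_one_sub (MeasurableSet.iInter hAm), heq, bondessonTruncBound_eq hα0 hc,
    sub_le_sub_iff_left]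
  have hw := integrable_one_sub_one_sub_pow hγ hα0 hc N K
  rw [integral_integral_swap (f := fun v t => 1 - (1 - v * Real.exp (-t / (γ * α))) ^ N) hw]
  set J : ℝ → ℝ := fun t => ∫ v, (1 - (1 - v * Real.exp (-t / (γ * α))) ^ N) ∂(betaRate γ α 0)
    with hJ
  have hJi : Integrable J (gammaLaw K) := hw.integral_prod_right
  have hJm : Measurable J := by
    have : StronglyMeasurable fun z : ℝ × ℝ => 1 - (1 - z.2 * Real.exp (-z.1 / (γ * α))) ^ N :=
      (by fun_prop : Measurable _).stronglyMeasurable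
    exact this.integral_prod_right'.measurable
  have hJ0 : ∀ᵐ t ∂(gammaLaw K), 0 ≤ J t := by
    filter_upwards [gammaLaw_ae K] with t ht
    refine integral_nonneg_of_ae ?_
    filter_upwards [betaRate_ae hα0] with v hv
    exact (one_sub_one_sub_pow_bounds hc hv ht N).1
  have hexpi : Integrable (fun t => Real.exp (-J t)) (gammaLaw K) := by
    refine (integrable_const (1 : ℝ)).mono' (by fun_prop) ?_
    filter_upwards [hJ0] with t ht
    rw [Real.norm_of_nonneg (Real.exp_pos _).le]
    exact Real.exp_le_one_iff.2 (neg_nonpos.2 ht)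
  have hlaw := h.isMarkedArrivals
  have := isProbabilityMeasure_betaOne (sub_nonneg.2 hα)
  have hE : ∫ ω, Real.exp (-∫ θ, (1 - φ (θ * Real.exp (-arrival E K ω / (γ * α))))
      ∂(betaRate γ α 0)) ∂P = ∫ t, Real.exp (-J t) ∂(gammaLaw K) := by
    rw [← hlaw.map_arrival K, integral_map (hlaw.measurable_arrival K).aemeasurable
      (by fun_prop)]
    refine integral_congr_ae ?_
    filter_upwards [hlaw.ae_pos] with ω hω
    have hs : 0 ≤ arrival E K ω := Finset.sum_nonneg fun i _ => (hω i).le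
    simp only [hJ]
    congr 2
    refine integral_congr_ae ?_
    filter_upwards [betaRate_ae hα0] with v hv
    obtain ⟨_, _, h3, h4⟩ := one_sub_one_sub_pow_bounds hc hv hs N
    rw [hφv _ ⟨h3, h4.trans hv.2.le⟩]
  rw [hE, ← integral_neg]
  -- Jensen for the convex exponential, applied to `-J` under the law of `Γ_K`.
  exact convexOn_exp.map_integral_le Real.continuous_exp.continuousOn isClosed_univ
    (ae_of_all _ fun _ => mem_univ _) hJi.neg hexpi

end Bound
end TruncRM

-- Assembly of the three statements

theorem mainTheorem1 {Ω Ψ 𝒴 : Type*} [MeasurableSpace Ω] [MeasurableSpace Ψ]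
    [MeasurableSpace 𝒴] (P : Measure Ω) [IsProbabilityMeasure P]
    (G : Measure Ψ) [IsProbabilityMeasure G] (γ α : ℝ) (hγ : 0 < γ) (hα : 0 < α) :
    -- the Bondesson representation
    (1 ≤ α → ∀ Θ : Ω → Measure Ψ,
      TruncRM.IsBondessonRep P G (γ * α) (TruncRM.betaOne (α - 1)) Θ →
        TruncRM.IsBetaProcess P G γ α 0 Θ) ∧
    -- its truncation error under the Bernoulli likelihood
    (1 ≤ α → ∀ (N K : ℕ),
      (∀ (E V : ℕ → Ω → ℝ) (ψ : ℕ → Ω → Ψ),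
        TruncRM.IsBondessonInput P G (TruncRM.betaOne (α - 1)) E V ψ →
        ∀ x z : Fin N → ℕ → Ω → ℕ,
          TruncRM.IsLikelihoodArray P TruncRM.bernoulliLikelihood
            (TruncRM.bondessonWeight (γ * α) E V) ψ x →
          TruncRM.IsLikelihoodArray P TruncRM.bernoulliLikelihood
            (TruncRM.bondessonWeight (γ * α) E V) ψ z →
          (∀ (f : Kernel (Measure Ψ) 𝒴) [IsMarkovKernel f] (m : Measure (Fin N → 𝒴))
            (p q : (Fin N → 𝒴) → ℝ),
            TruncRM.IsMarginalDensity P f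
              (fun n ω => TruncRM.atomicMeasure (fun k => (x n k ω : ℝ)) (fun k => ψ k ω)) m p →
            TruncRM.IsMarginalDensity P f
              (fun n ω => TruncRM.atomicMeasureTrunc K (fun k => (z n k ω : ℝ))
                (fun k => ψ k ω)) m q →
            (1 / 2) * ∫ y, |p y - q y| ∂m ≤ P.real {ω | ∃ n k, K ≤ k ∧ x n k ω ≠ 0}) ∧
          P.real {ω | ∃ n k, K ≤ k ∧ x n k ω ≠ 0} ≤
            TruncRM.bondessonTruncBound TruncRM.bernoulliLikelihood
              (TruncRM.betaRate γ α 0) (γ * α) N K) ∧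
      TruncRM.bondessonTruncBound TruncRM.bernoulliLikelihood
          (TruncRM.betaRate γ α 0) (γ * α) N K ≤
        N * γ * (γ * α / (1 + γ * α)) ^ K) ∧
    -- superposition with a Poisson number of beta distributed atoms, for every `α > 0`
    (∀ (Θ : Ω → Measure Ψ) (C : Ω → ℕ) (θ' : ℕ → Ω → ℝ) (ψ' : ℕ → Ω → Ψ),
      TruncRM.IsBetaProcess P G (γ * α / (α + 1)) (α + 1) 0 Θ →
      TruncRM.IsCompoundInput P G γ (betaMeasure 1 α) C θ' ψ' →
      IndepFun Θ (fun ω => (C ω, fun k : ℕ => (θ' k ω, ψ' k ω))) P →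
      TruncRM.IsBetaProcess P G γ α 0
        (fun ω => Θ ω +
          TruncRM.atomicMeasureTrunc (C ω) (fun k => θ' k ω) (fun k => ψ' k ω))) := by
  refine ⟨fun h1 Θ hΘ => TruncRM.isBetaProcess_of_isBondessonRep hγ h1 hΘ, fun h1 N K => ⟨?_, ?_⟩,
    fun Θ C θ' ψ' hΘ hC hind => TruncRM.isBetaProcess_add_compound hγ hα hΘ hC hind⟩
  · intro E V ψ hin x z hx hz
    refine ⟨fun f _ m p q hp hq => ?_, TruncRM.measureReal_exists_ne_zero_le hγ h1 hin K hx⟩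
    exact TruncRM.half_integral_abs_sub_le (hin.measurable_weight _) hin.measurable_ψ hx hz hp hq
  · exact TruncRM.bondessonTruncBound_le hγ hα N K
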